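/- **Setting.** Let $P$ be a finite logic program (a list of rules $H \,{:\!-}\, B_1,\dots,B_n$), $\leftarrow Q$ a query (a finite list of atoms), and consider an LD-tree for $P$ and $Q$, i.e. the SLD-tree in which always the first atom of a goal is resolved: a node with goal $\leftarrow p_1,\dots,p_m$ ($m\ge 1$) has one child for each rule of $P$ whose head, after renaming apart, unifies with $p_1$; the child's goal is the resolvent obtained with a most general unifier. A node $b$ is a *direct offspring* of a node $a$ if the first atom of $b$ originates (up to substitution) from a body atom of the rule with which $a$ was resolved on the way to $b$; *offspring* is the transitive closure. A *call branch* is the path from a node to one of its offspring. A *symbolic linear norm* is given by $\|f(t_1,\dots,t_n)\| = c+\sum_i a_i\|t_i\|$ with non-negative integers $c,a_i$ depending only on $f/n$; the norm of a logical variable is an integer variable. So norms are linear expressions. A term is *instantiated enough* if its norm is an integer. Call a linear expression *positive* if its coefficients are $\ge 0$ and its constant term is $>0$. A *mixed graph* has black and white nodes, (undirected) edges between distinct nodes, and arcs. A *positive cycle* is a closed path of edges and arcs with at least one arc; a graph is *consistent* if it has none. $G_1$ is *subsumed by* $G_2$ (same nodes) if every black node, edge and arc of $G_2$ is one of $G_1$.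 A *query-mapping pair* $(\pi,\mu)$ consists of a mixed graph $\pi$ (the query) on the argument positions of a predicate $p$ and a mixed graph $\mu$ (the mapping) on the argument positions of $p$ (the domain) and of a predicate $q$ (the range). If $p=q$ and $\pi$ is identical to the range of $\mu$, the *circular variant* of $(\pi,\mu)$ arises by adding to $\mu$ a circular edge between each node of the range and the corresponding node of the domain; it has a *forward positive cycle* if it has a cycle with at least one arc in which all circular edges are traversed from the range to the domain. **Generation.** The *weighted rule graph* of a rule has as nodes the argument positions of its atoms; edges connect distinct positions whose arguments have equal norms; and there is a potential arc from $x$ to $y$ labelled $\|x\|-\|y\|$ whenever this difference is positive. As result of instantiation analysis and constraint inference, fix for each predicate a set of disjuncts, each of which states that certain arguments are instantiated enough (ie) or not (nie), that certain pairs of arguments have equal norms, and that for certain pairs the difference of the norms is positive. It is assumed to be correct: every (possibly non-ground) atom in the success set of $P$ satisfies some disjunct for its predicate. (It may be trivial, i.e. state nothing.) Given a rule $r$, a subgoal $s$ in its body, a query $\pi$ for the head predicate, and one disjunct for each subgoal preceding $s$, the *augmented argument mapping* is the following mixed graph on the argument positions of the head, of $s$ and of the subgoals preceding $s$. Consider paths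 consisting of edges of the weighted rule graph, edges of $\pi$ (on the head) and norm equalities of the disjuncts; of arcs of $\pi$ and norm inequalities of the disjuncts; and of potential arcs traversed forwards (weight counted positively) or backwards (weight counted negatively). Two distinct positions are connected by an edge if there is such a path without arcs and inequalities between them with total weight $0$. The black nodes form the least set containing the nodes that are black in $\pi$ or ie in a disjunct, every node whose norm contains only variables that occur in the norms of black nodes, and every node connected by an edge with a black node. There is an arc from $x$ to $y$ if both are black and there is a path from $x$ to $y$ such that the total weight plus the number of arcs and inequalities on it is positive. It is *consistent* if it has no positive cycle and no node that is nie in a chosen disjunct is black; its *summary* is then its restriction to the domain (the head) and the range ($s$). **Composition.** The composition of $(\pi_1,\mu_1)$ and $(\pi_2,\mu_2)$ exists if the range of $\mu_1$ is identical to $\pi_2$ and the following graph is consistent; it is then $(\pi_1,\mu)$, where $\mu$ is the restriction to the domain of $\mu_1$ and the range of $\mu_2$ of that graph. The graph is the transitive closure of the union of $\mu_1$ and $\mu_2$ with the range of $\mu_1$ identified with the domain of $\mu_2$: nodes connected by a path of edges with a black node are black, paths of edges give edges, and paths of edges and arcs with at least one arc give arcs. **The shadow.** Every node with non-empty goal gets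 a query: a node whose first atom comes from the original query gets an arbitrary query pattern that subsumes the abstraction of this atom (black: instantiated enough; edges: equal norms; arcs: larger to smaller integer norm); a node $b$ that is a direct offspring of $a$ gets the range of the mapping of $\alpha_{app}$ for the branch from $a$ to $b$. For this branch, which belongs to a subgoal $s$ of a rule $r$, $\alpha_{app}$ is $(\pi,\mu)$ with $\pi$ the query of $a$ and $\mu$ the summary of the augmented argument mapping for $r$, $s$, $\pi$ (undefined if that is inconsistent), where for each subgoal $B_k$ preceding $s$ one uses an arbitrary disjunct that is satisfied by $B_k\theta$, the instance of $B_k$ under the composition $\theta$ of the unifiers from $a$ to $b$. For the other call branches $\alpha_{app}$ is defined by composition. **Theorem 5.** Let an LD-tree for a query and a program and a symbolic linear norm be given, and let $\alpha_{app}$ be defined as above. If every circular variant that can be created from the query-mapping pairs in the image of $\alpha_{app}$ has a forward positive cycle, then the LD-tree is finite, i.e. the query terminates with Prolog's computation rule. -/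

import Mathlib

universe u v

namespace TermiLog

noncomputable section

/-! ## Logic programs

Function symbols and predicate symbols are those of a first-order language `L`; the
variables are the natural numbers. -/

/-- A predicate symbol together with its arity. -/
abbrev Pred (L : FirstOrder.Language.{u, v}) := Σ n : ℕ, L.Relations n

/-- The arity of a predicate. -/
abbrev Pred.arity {L : FirstOrder.Language.{u, v}} (p : Pred L) : ℕ := p.1

/-- A substitution. -/
abbrev Subst (L : FirstOrder.Language.{u, v}) := ℕ → L.Term ℕ

/-- Composition of substitutions: first `σ`, then `τ`. -/
def Subst.comp {L : FirstOrder.Language.{u, v}} (σ τ : Subst L) : Subst L :=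
  fun x => (σ x).subst τ

/-- The variables moved by `σ`, and those occurring in the terms they are replaced by. -/
def Subst.vars {L : FirstOrder.Language.{u, v}} (σ : Subst L) : Set ℕ :=
  {y | ∃ x, σ x ≠ FirstOrder.Language.Term.var x ∧ (y = x ∨ y ∈ (σ x).varFinset)}

/-- An atom `p(t₁,…,tₙ)`. -/
structure Atom (L : FirstOrder.Language.{u, v}) where
  pred : Pred L
  args : Fin pred.arity → L.Term ℕ

/-- The result of applying a substitution to an atom. -/
def Atom.subst {L : FirstOrder.Language.{u, v}} (A : Atom L) (σ : Subst L) : Atom L :=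
  ⟨A.pred, fun i => (A.args i).subst σ⟩

def Atom.vars {L : FirstOrder.Language.{u, v}} (A : Atom L) : Set ℕ :=
  {x | ∃ i, x ∈ (A.args i).varFinset}

/-- A rule (clause) `head :- body₀, …, bodyₘ₋₁`. -/
structure Clause (L : FirstOrder.Language.{u, v}) where
  head : Atom L
  body : List (Atom L)

/-- The variables of the rule renamed by a permutation of the variables. -/
def renameVars (L : FirstOrder.Language.{u, v}) (ρ : Equiv.Perm ℕ) : Subst L :=
  fun x => FirstOrder.Language.Term.var (ρ x)

/-- The variables of the variant of the rule `C` obtained by the renaming `ρ`. -/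
def Clause.variantVars {L : FirstOrder.Language.{u, v}} (C : Clause L) (ρ : Equiv.Perm ℕ) :
    Set ℕ :=
  {x | x ∈ (C.head.subst (renameVars L ρ)).vars ∨
    ∃ B ∈ C.body, x ∈ (B.subst (renameVars L ρ)).vars}

/-- A program: a finite list of rules. -/
abbrev Program (L : FirstOrder.Language.{u, v}) := List (Clause L)

/-- `θ` is a most general unifier of `A` and `B`. -/
def IsMGU {L : FirstOrder.Language.{u, v}} (θ : Subst L) (A B : Atom L) : Prop :=
  A.subst θ = B.subst θ ∧
    ∀ σ : Subst L, A.subst σ = B.subst σ → ∃ γ : Subst L, σ = θ.comp γ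

/-- The (possibly non-ground) atoms that follow from the program, i.e. its success set. -/
inductive Success {L : FirstOrder.Language.{u, v}} (P : Program L) : Atom L → Prop
  | intro (C : Clause L) (hC : C ∈ P) (σ : Subst L)
      (hbody : ∀ B ∈ C.body, Success P (B.subst σ)) : Success P (C.head.subst σ)

/-! ## LD-trees -/

/-- The address of a node: the rules applied on the way from the root, the last one first.
The children of the node `a` have addresses `i :: a`. -/
abbrev Addr {L : FirstOrder.Language.{u, v}} (P : Program L) := List (Fin P.length)

/-- Where an atom of a goal comes from: it entered when node `node` was resolved with the rule
number `rule`, as the body atom of that rule with number `sub`. -/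
structure Origin {L : FirstOrder.Language.{u, v}} (P : Program L) where
  node : Addr P
  rule : Fin P.length
  sub : Fin (P.get rule).body.length

/-- An atom of a goal, labelled with its origin (`none` for the atoms of the query). -/
structure GoalAtom {L : FirstOrder.Language.{u, v}} (P : Program L) where
  atom : Atom L
  origin : Option (Origin P)

def GoalAtom.subst {L : FirstOrder.Language.{u, v}} {P : Program L} (x : GoalAtom P)
    (σ : Subst L) : GoalAtom P :=
  ⟨x.atom.subst σ, x.origin⟩

/-- The goal obtained by resolving the first atom of a goal with the rule number `i`, renamed by
`ρ`, using the unifier `θ`; `rest` are the remaining atoms of that goal, at node `a`. -/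
def resolvent {L : FirstOrder.Language.{u, v}} (P : Program L) (a : Addr P) (i : Fin P.length)
    (ρ : Equiv.Perm ℕ) (θ : Subst L) (rest : List (GoalAtom P)) : List (GoalAtom P) :=
  (((List.finRange (P.get i).body.length).map fun s =>
    (⟨((P.get i).body.get s).subst (renameVars L ρ), some ⟨a, i, s⟩⟩ : GoalAtom P)) ++ rest).map
      fun x => x.subst θ

/-- An LD-tree for the program `P` and the query `← Q`: the SLD-tree in which always the first
atom of the goal is resolved. Every node has one child for each rule whose head, after renaming
apart, unifies with the first atom of the goal. -/
structure LDTree {L : FirstOrder.Language.{u, v}} (P : Program L) (Q : List (Atom L)) where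
  /-- the addresses of the nodes -/
  nodes : Set (Addr P)
  /-- the goal at a node -/
  goal : Addr P → List (GoalAtom P)
  /-- the renaming applied to a rule at a node -/
  ren : Addr P → Fin P.length → Equiv.Perm ℕ
  /-- the unifier used when a node is resolved with a rule -/
  mgu : Addr P → Fin P.length → Subst L
  root_mem : [] ∈ nodes
  goal_root : goal [] = Q.map fun A => ⟨A, none⟩
  mem_cons_iff : ∀ (a : Addr P) (i : Fin P.length), i :: a ∈ nodes ↔
    a ∈ nodes ∧ ∃ x rest, goal a = x :: rest ∧
      ∃ σ : Subst L, x.atom.subst σ = ((P.get i).head.subst (renameVars L (ren a i))).subst σ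
  isMGU : ∀ (a : Addr P) (i : Fin P.length), i :: a ∈ nodes → ∀ x rest, goal a = x :: rest →
    IsMGU (mgu a i) x.atom ((P.get i).head.subst (renameVars L (ren a i)))
  goal_cons : ∀ (a : Addr P) (i : Fin P.length), i :: a ∈ nodes → ∀ x rest,
    goal a = x :: rest → goal (i :: a) = resolvent P a i (ren a i) (mgu a i) rest
  /-- The variants are variable disjoint from the query and from the variants and the unifiers
  used above. -/
  apart_query : ∀ a ∈ nodes, ∀ (i : Fin P.length), ∀ A ∈ Q,
    Disjoint ((P.get i).variantVars (ren a i)) A.vars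
  apart_above : ∀ a ∈ nodes, ∀ (i : Fin P.length), ∀ (b : Addr P) (j : Fin P.length),
    j :: b <:+ a →
      Disjoint ((P.get i).variantVars (ren a i)) ((P.get j).variantVars (ren b j)) ∧
      Disjoint ((P.get i).variantVars (ren a i)) (mgu b j).vars

variable {L : FirstOrder.Language.{u, v}} {P : Program L} {Q : List (Atom L)}

/-- The composition of the unifiers on the path from the node `a` down to the node `l ++ a`. -/
def LDTree.along (T : LDTree P Q) (a : Addr P) : Addr P → Subst L
  | [] => fun x => FirstOrder.Language.Term.var x
  | i :: l => (LDTree.along T a l).comp (T.mgu (l ++ a) i)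

/-- The node `b` is a direct offspring of the node `a`: its first atom is an instance of the body
atom number `s` of the rule number `i`, with which `a` was resolved on the way to `b`. -/
def LDTree.DirectOffspring (T : LDTree P Q) (a b : Addr P) (i : Fin P.length)
    (s : Fin (P.get i).body.length) : Prop :=
  b ∈ T.nodes ∧ ∃ x rest, T.goal b = x :: rest ∧ x.origin = some ⟨a, i, s⟩

/-! ## Symbolic linear norms -/

/-- Linear expressions in the variables with integer coefficients, as pairs of the constant term
and the coefficients. -/
abbrev LinExpr := ℤ × (ℕ →₀ ℤ)

/-- The value is positive and stays positive whatever non-negative values the variables take: the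
coefficients are non-negative and the constant term is positive. -/
def LinExpr.Pos (e : LinExpr) : Prop := (∀ x, 0 ≤ e.2 x) ∧ 0 < e.1

/-- The data of a symbolic linear norm
`‖f(X₁,…,Xₙ)‖ = const f + coeff f 1 * ‖X₁‖ + … + coeff f n * ‖Xₙ‖`. -/
structure SymbolicNorm (L : FirstOrder.Language.{u, v}) where
  const : ∀ {n : ℕ}, L.Functions n → ℕ
  coeff : ∀ {n : ℕ}, L.Functions n → Fin n → ℕ

/-- The symbolic norm of a term. -/
def SymbolicNorm.norm (N : SymbolicNorm L) : L.Term ℕ → LinExpr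
  | .var x => (0, Finsupp.single x 1)
  | .func f ts => ((N.const f : ℤ), 0) + ∑ i, (N.coeff f i : ℤ) • N.norm (ts i)

/-- The symbolic norm of the term is an integer. -/
def SymbolicNorm.InstEnough (N : SymbolicNorm L) (t : L.Term ℕ) : Prop := (N.norm t).2 = 0

/-! ## Mixed graphs -/

/-- A graph with black and white nodes, edges and arcs. -/
@[ext]
structure MixedGraph (V : Type*) where
  black : Set V
  edges : SimpleGraph V
  arcs : V → V → Prop

namespace MixedGraph

variable {V W : Type*}

/-- One step along an edge (in either direction) or along an arc. -/
def Step (G : MixedGraph V) (x y : V) : Prop := G.edges.Adj x y ∨ G.arcs x y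

/-- There is no positive cycle, i.e. no cycle of edges and arcs with at least one arc. -/
def Consistent (G : MixedGraph V) : Prop :=
  ¬ ∃ x y, G.arcs x y ∧ Relation.ReflTransGen G.Step y x

/-- `G₁.SubsumedBy G₂`: what `G₂` says also holds in `G₁`. -/
def SubsumedBy (G₁ G₂ : MixedGraph V) : Prop :=
  G₂.black ⊆ G₁.black ∧ G₂.edges ≤ G₁.edges ∧ ∀ x y, G₂.arcs x y → G₁.arcs x y

/-- The graph induced along a map of nodes (only used for injective maps). -/
def restrict (f : W → V) (G : MixedGraph V) : MixedGraph W where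
  black := f ⁻¹' G.black
  edges := G.edges.comap f
  arcs x y := G.arcs (f x) (f y)

/-- Transitive closure: paths of edges give edges, paths with at least one arc give arcs, and
nodes connected with a black node by edges become black. -/
def closure (G : MixedGraph V) : MixedGraph V where
  black := {x | ∃ y ∈ G.black, G.edges.Reachable y x}
  edges := SimpleGraph.fromRel G.edges.Reachable
  arcs x y := ∃ x' y', Relation.ReflTransGen G.Step x x' ∧ G.arcs x' y' ∧
    Relation.ReflTransGen G.Step y' y

/-- The union of two graphs on the disjoint union of the three node sets, the nodes of `B` in the
two graphs being identified. -/
def glue {A B C : Type*} (G : MixedGraph (A ⊕ B)) (H : MixedGraph (B ⊕ C)) :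
    MixedGraph (A ⊕ (B ⊕ C)) where
  black := Sum.map id Sum.inl '' G.black ∪ Sum.inr '' H.black
  edges := G.edges.map (Sum.map id Sum.inl) ⊔ H.edges.map Sum.inr
  arcs x y := Relation.Map G.arcs (Sum.map id Sum.inl) (Sum.map id Sum.inl) x y ∨
    Relation.Map H.arcs Sum.inr Sum.inr x y

end MixedGraph

/-! ## Query-mapping pairs -/

/-- A query for the predicate `p`: a mixed graph on its argument positions. -/
abbrev Query (p : Pred L) := MixedGraph (Fin p.arity)

/-- A mapping with domain predicate `p` and range predicate `q`: a mixed graph on the argument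
positions of `p` (the domain) and of `q` (the range). -/
abbrev Mapping (p q : Pred L) := MixedGraph (Fin p.arity ⊕ Fin q.arity)

/-- The range of a mapping, as a query. -/
def Mapping.range {p q : Pred L} (μ : Mapping p q) : Query q := μ.restrict Sum.inr

/-- A query-mapping pair. -/
structure QMPair (p q : Pred L) where
  query : Query p
  map : Mapping p q

/-- `D` is the composition of the pairs `A` and `B`. It exists only if the range of the mapping of
`A` is the query of `B` and the composition of the mappings is consistent; its mapping is the
summary of the composition of the two mappings. -/
def QMPair.IsComp {p q r : Pred L} (A : QMPair p q) (B : QMPair q r) (D : QMPair p r) : Prop :=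
  Mapping.range A.map = B.query ∧
  (MixedGraph.glue A.map B.map).closure.Consistent ∧
  D.query = A.query ∧
  D.map = (MixedGraph.glue A.map B.map).closure.restrict (Sum.map id Sum.inr)

/-- A recursive pair, i.e. one that has a circular variant: the query is identical to the range of
the mapping. -/
def QMPair.Circular {p : Pred L} (A : QMPair p p) : Prop := A.query = Mapping.range A.map

/-- One step in the circular variant: along an edge, along an arc, or along a circular edge from a
node of the range to the corresponding node of the domain. -/
def QMPair.CircularStep {p : Pred L} (A : QMPair p p) (x y : Fin p.arity ⊕ Fin p.arity) : Prop :=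
  A.map.Step x y ∨ ∃ i, x = Sum.inr i ∧ y = Sum.inl i

/-- The circular variant has a cycle with at least one arc in which the circular edges are
traversed from the range to the domain. -/
def QMPair.HasForwardPositiveCycle {p : Pred L} (A : QMPair p p) : Prop :=
  ∃ x y, A.map.arcs x y ∧ Relation.ReflTransGen A.CircularStep y x

/-- The abstraction of an atom: instantiated enough arguments are black, edges connect arguments
with the same norm, arcs go from an argument with larger integer norm to one with smaller integer
norm. -/
def absQuery (N : SymbolicNorm L) (A : Atom L) : Query A.pred where
  black := {i | N.InstEnough (A.args i)}
  edges := SimpleGraph.fromRel fun i j => N.norm (A.args i) = N.norm (A.args j)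
  arcs i j := N.InstEnough (A.args i) ∧ N.InstEnough (A.args j) ∧
    (N.norm (A.args j)).1 < (N.norm (A.args i)).1

/-! ## Results of instantiation analysis and constraint inference -/

/-- A description of the answers for a predicate of arity `n`: arguments that are instantiated
enough (`ie`), arguments that are not (`nie`), pairs of arguments with equal norms (`eq`), and
pairs whose first argument has the larger norm (`gt`). Nothing is claimed about arguments in
neither of the sets `ie`, `nie`. -/
structure AnswerInfo (n : ℕ) where
  ie : Set (Fin n)
  nie : Set (Fin n)
  eq : Fin n → Fin n → Prop
  gt : Fin n → Fin n → Prop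

/-- The description is correct for the atom `A`. -/
def AnswerInfo.Describes (N : SymbolicNorm L) (A : Atom L) (d : AnswerInfo A.pred.arity) : Prop :=
  (∀ i ∈ d.ie, N.InstEnough (A.args i)) ∧
  (∀ i ∈ d.nie, ¬ N.InstEnough (A.args i)) ∧
  (∀ i j, d.eq i j → N.norm (A.args i) = N.norm (A.args j)) ∧
  (∀ i j, d.gt i j → LinExpr.Pos (N.norm (A.args i) - N.norm (A.args j)))

/-- The result of instantiation analysis and constraint inference: for each predicate a
disjunction (set) of descriptions. -/
abbrev AnswerTable (L : FirstOrder.Language.{u, v}) := (p : Pred L) → Set (AnswerInfo p.arity)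

/-- The table is correct for the program: each atom in the success set is described by one of the
disjuncts. (In particular, a table that claims nothing is correct.) -/
def AnswerTable.Sound (N : SymbolicNorm L) (P : Program L) (tab : AnswerTable L) : Prop :=
  ∀ A : Atom L, Success P A → ∃ d ∈ tab A.pred, AnswerInfo.Describes N A d

/-- For each node `b`, a disjunct for each body atom of each rule. Those used are the ones for the
subgoals preceding the first atom of `b` in the rule from which that atom comes. -/
abbrev DisjunctChoice (P : Program L) :=
  (b : Addr P) → (i : Fin P.length) → (k : Fin (P.get i).body.length) →
    AnswerInfo ((P.get i).body.get k).pred.arity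

/-- Let `b = l ++ a` be a direct offspring of `a` by the body atom number `s` of the rule number
`i`. For each preceding subgoal the chosen disjunct is one that describes the answer found for
this subgoal between `a` and `b`, whenever the table has such a disjunct. -/
def DisjunctChoice.Fits (N : SymbolicNorm L) (T : LDTree P Q) (tab : AnswerTable L)
    (ch : DisjunctChoice P) : Prop :=
  ∀ (a l : Addr P) (i : Fin P.length) (s : Fin (P.get i).body.length),
    T.DirectOffspring a (l ++ a) i s → ∀ k < s,
      (∃ d ∈ tab ((P.get i).body.get k).pred, AnswerInfo.Describes N
        ((((P.get i).body.get k).subst (renameVars L (T.ren a i))).subst (T.along a l)) d) →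
      ch (l ++ a) i k ∈ tab ((P.get i).body.get k).pred ∧ AnswerInfo.Describes N
        ((((P.get i).body.get k).subst (renameVars L (T.ren a i))).subst (T.along a l))
        (ch (l ++ a) i k)

/-! ## Weighted rule graphs and augmented argument mappings -/

/-- The argument positions of a rule. -/
inductive RuleNode (C : Clause L) : Type
  | head (i : Fin C.head.pred.arity) : RuleNode C
  | body (k : Fin C.body.length) (i : Fin (C.body.get k).pred.arity) : RuleNode C

/-- The argument at a position. -/
def RuleNode.term {C : Clause L} : RuleNode C → L.Term ℕ
  | .head i => C.head.args i
  | .body k i => (C.body.get k).args i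

/-- A graph with edges and arcs labelled by linear expressions. -/
structure WeightedGraph (V : Type*) where
  edges : SimpleGraph V
  potential : V → V → LinExpr → Prop

/-- The weighted rule graph: edges connect arguments with equal norms; there is a potential arc
between arguments such that the difference of the norms has non-negative coefficients and a
positive constant term, labelled by this difference. -/
def weightedRuleGraph (N : SymbolicNorm L) (C : Clause L) : WeightedGraph (RuleNode C) where
  edges := SimpleGraph.fromRel fun x y => N.norm x.term = N.norm y.term
  potential x y e := e = N.norm x.term - N.norm y.term ∧ LinExpr.Pos e

/-- The position is in the head, in the subgoal number `s`, or in a preceding subgoal. -/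
def RuleNode.UpTo {C : Clause L} (s : Fin C.body.length) : RuleNode C → Prop
  | .head _ => True
  | .body k _ => k ≤ s

/-- The nodes of the augmented argument mapping for the subgoal number `s`. -/
abbrev AugNode (C : Clause L) (s : Fin C.body.length) := {x : RuleNode C // x.UpTo s}

/-- The nodes of the domain and of the range. -/
def AugNode.ofArg (C : Clause L) (s : Fin C.body.length) :
    Fin C.head.pred.arity ⊕ Fin (C.body.get s).pred.arity → AugNode C s
  | .inl i => ⟨.head i, trivial⟩
  | .inr i => ⟨.body s i, le_refl s⟩

section Augmented

variable (N : SymbolicNorm L) (C : Clause L) (s : Fin C.body.length) (π : Query C.head.pred)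
  (info : (k : Fin C.body.length) → AnswerInfo (C.body.get k).pred.arity)

/-- The edges from which the derivation starts: those of the weighted rule graph, of the query, and
of the descriptions of the answers for the preceding subgoals. -/
inductive BaseEdge : AugNode C s → AugNode C s → Prop
  | rule (x y : AugNode C s) :
      (weightedRuleGraph N C).edges.Adj x.1 y.1 → BaseEdge x y
  | query (i j : Fin C.head.pred.arity) :
      π.edges.Adj i j → BaseEdge (AugNode.ofArg C s (.inl i)) (AugNode.ofArg C s (.inl j))
  | answer (k : Fin C.body.length) (hk : k < s) (i j : Fin (C.body.get k).pred.arity) :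
      (info k).eq i j → BaseEdge ⟨.body k i, hk.le⟩ ⟨.body k j, hk.le⟩

/-- The inequalities from which the derivation starts: the arcs of the query, and those of the
descriptions of the answers for the preceding subgoals. -/
inductive BaseArc : AugNode C s → AugNode C s → Prop
  | query (i j : Fin C.head.pred.arity) :
      π.arcs i j → BaseArc (AugNode.ofArg C s (.inl i)) (AugNode.ofArg C s (.inl j))
  | answer (k : Fin C.body.length) (hk : k < s) (i j : Fin (C.body.get k).pred.arity) :
      (info k).gt i j → BaseArc ⟨.body k i, hk.le⟩ ⟨.body k j, hk.le⟩

/-- `Derives … x y e n`: there is a path from `x` to `y` consisting of edges, of `n` arcs, and of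
weighted arcs traversed forwards or backwards, with weights adding up to `e` (a weight counts
negatively when traversed backwards). So the norm at `x` is the norm at `y` plus `e` plus `n`
positive quantities. -/
inductive Derives : AugNode C s → AugNode C s → LinExpr → ℕ → Prop
  | refl (x : AugNode C s) : Derives x x 0 0
  | edge {x y z : AugNode C s} {e : LinExpr} {n : ℕ} : Derives x y e n →
      (BaseEdge N C s π info y z ∨ BaseEdge N C s π info z y) → Derives x z e n
  | arc {x y z : AugNode C s} {e : LinExpr} {n : ℕ} : Derives x y e n →
      BaseArc C s π info y z → Derives x z e (n + 1)
  | forward {x y z : AugNode C s} {e w : LinExpr} {n : ℕ} : Derives x y e n →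
      (weightedRuleGraph N C).potential y.1 z.1 w → Derives x z (e + w) n
  | backward {x y z : AugNode C s} {e w : LinExpr} {n : ℕ} : Derives x y e n →
      (weightedRuleGraph N C).potential z.1 y.1 w → Derives x z (e - w) n

/-- The black nodes: those that are black in the query; those that are instantiated enough by the
descriptions of the answers for the preceding subgoals; those whose norm contains only variables
that occur in the norm of black nodes; and those connected with a black node by an edge. -/
inductive Black : AugNode C s → Prop
  | query (i : Fin C.head.pred.arity) : i ∈ π.black → Black (AugNode.ofArg C s (.inl i))
  | answer (k : Fin C.body.length) (hk : k < s) (i : Fin (C.body.get k).pred.arity) :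
      i ∈ (info k).ie → Black ⟨.body k i, hk.le⟩
  | rule (x : AugNode C s) (y : ℕ → AugNode C s) :
      (∀ v ∈ (N.norm x.1.term).2.support, Black (y v)) →
      (∀ v ∈ (N.norm x.1.term).2.support, v ∈ (N.norm (y v).1.term).2.support) → Black x
  | edge (x y : AugNode C s) : Black x → Derives N C s π info x y 0 0 → Black y

/-- The augmented argument mapping for the rule `C`, its subgoal number `s`, the query `π`, and the
chosen disjuncts. An edge is derived by a path without arcs whose weights add up to zero; an arc
is derived between black nodes by a path showing that the norm at the first node exceeds that at
the second one by at least a positive integer. -/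
def augmentedMapping : MixedGraph (AugNode C s) where
  black := {x | Black N C s π info x}
  edges := SimpleGraph.fromRel fun x y => Derives N C s π info x y 0 0
  arcs x y := Black N C s π info x ∧ Black N C s π info y ∧
    ∃ (e : LinExpr) (n : ℕ), Derives N C s π info x y e n ∧ LinExpr.Pos (e + ((n : ℤ), 0))

/-- The augmented argument mapping has no positive cycle, and no argument which is not instantiated
enough according to a chosen disjunct is black. -/
def AugConsistent : Prop :=
  (augmentedMapping N C s π info).Consistent ∧
  ∀ (k : Fin C.body.length) (hk : k < s) (i : Fin (C.body.get k).pred.arity),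
    i ∈ (info k).nie → ¬ Black N C s π info ⟨.body k i, hk.le⟩

/-- The summary: what the augmented argument mapping says about its domain and its range. -/
def summary : Mapping C.head.pred (C.body.get s).pred :=
  (augmentedMapping N C s π info).restrict (AugNode.ofArg C s)

end Augmented

/-! ## The structured shadow -/

section Shadow

variable (N : SymbolicNorm L) (T : LDTree P Q) (init : (b : Addr P) → (p : Pred L) → Query p)
  (ch : DisjunctChoice P)

/-- `init` gives for each node whose first atom comes from the query a query pattern that
subsumes the abstraction of this atom. -/
def InitFits : Prop :=
  ∀ b ∈ T.nodes, ∀ x rest, T.goal b = x :: rest → x.origin = none →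
    (absQuery N x.atom).SubsumedBy (init b x.atom.pred)

/-- The query that the algorithm associates with a node: the initial query pattern, or the range
of the mapping by which the node is reached from the node of which it is a direct offspring. -/
inductive AppQuery : Addr P → (p : Pred L) → Query p → Prop
  | init (b : Addr P) (x : GoalAtom P) (rest : List (GoalAtom P)) : b ∈ T.nodes →
      T.goal b = x :: rest → x.origin = none → AppQuery b x.atom.pred (init b x.atom.pred)
  | call (a b : Addr P) (i : Fin P.length) (s : Fin (P.get i).body.length)
      (π : Query (P.get i).head.pred) : T.DirectOffspring a b i s →
      AppQuery a (P.get i).head.pred π → AugConsistent N (P.get i) s π (ch b i) →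
      AppQuery b ((P.get i).body.get s).pred
        (Mapping.range (summary N (P.get i) s π (ch b i)))

/-- `AlphaApp … a b p q A`: the shadow assigns to the call branch from the node `a` to the node `b`
the query-mapping pair `A`. Its values for direct offspring are given by summaries of augmented
argument mappings, and its other values by composition. -/
inductive AlphaApp : Addr P → Addr P → (p q : Pred L) → QMPair p q → Prop
  | direct (a b : Addr P) (i : Fin P.length) (s : Fin (P.get i).body.length)
      (π : Query (P.get i).head.pred) : T.DirectOffspring a b i s →
      AppQuery N T init ch a (P.get i).head.pred π → AugConsistent N (P.get i) s π (ch b i) →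
      AlphaApp a b (P.get i).head.pred ((P.get i).body.get s).pred
        ⟨π, summary N (P.get i) s π (ch b i)⟩
  | comp (a b c : Addr P) (p q r : Pred L) (A : QMPair p q) (B : QMPair q r) (D : QMPair p r) :
      AlphaApp a b p q A → AlphaApp b c q r B → A.IsComp B D → AlphaApp a c p r D

end Shadow

end

end TermiLog

/-! Suppose the tree is infinite. Every node has finitely many children, so there is an infinite
branch. From the nodes on it whose goals are no longer than any later goal, one extracts an infinite
chain of calls, each a direct offspring of its predecessor (`LDTree.exists_offspring_sequence`).

A mixed graph is read semantically (`SoundFor`): black means integer norm, an edge means equal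
norms, an arc means that both norms are integers and the second is smaller. In the mapping for a
branch from `a` to `b`, the domain is read after the first atom of `a` has been instantiated by the
unifiers up to `b`. Every derivation rule is valid for this reading: instantiation acts linearly on
norms, fixes integers, and preserves positivity because norms have nonnegative coefficients. A sound
graph has no positive cycle, so all summaries and compositions along the chain are consistent, and a
pair is assigned to any two of its calls (`Call.Valid.exists_link`, `Link.trans`). Composition can
be iterated because it leaves the range unchanged (`restrict_closure_glue`).

Only finitely many pairs exist over the predicates of the program, so by Ramsey's theorem some
infinite subsequence has one and the same pair between any two members. Its range at a call is also
its query there, so it is circular, and by hypothesis it has a forward positive cycle. Copies of the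
mapping are laid along the subsequence; a circular edge passes from the range of one copy to the
domain of the next, where the same atom is merely instantiated further. Each turn lowers a
nonnegative integer that later instantiation cannot change, which cannot go on forever
(`not_hasForwardPositiveCycle`). -/

namespace TermiLog

noncomputable section

open FirstOrder.Language (Term)

variable {L : FirstOrder.Language.{u, v}} {P : Program L} {Q : List (Atom L)}

/-! ## Norms under substitution -/

/-- The linear map on linear expressions that replaces each variable by the norm of the term
substituted for it. -/
def SymbolicNorm.lin (N : SymbolicNorm L) (σ : Subst L) : LinExpr →ₗ[ℤ] LinExpr :=
  (LinearMap.inl ℤ ℤ (ℕ →₀ ℤ)).coprod (Finsupp.linearCombination ℤ fun v => N.norm (σ v))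

theorem SymbolicNorm.lin_apply (N : SymbolicNorm L) (σ : Subst L) (e : LinExpr) :
    N.lin σ e = (e.1, 0) + e.2.sum fun v c => c • N.norm (σ v) := by
  simp [SymbolicNorm.lin, Finsupp.linearCombination_apply]

theorem SymbolicNorm.lin_const (N : SymbolicNorm L) (σ : Subst L) (c : ℤ) :
    N.lin σ (c, 0) = (c, 0) := by
  simp [SymbolicNorm.lin_apply]

theorem SymbolicNorm.lin_of_snd_eq_zero (N : SymbolicNorm L) (σ : Subst L) {e : LinExpr}
    (he : e.2 = 0) : N.lin σ e = e := by
  obtain ⟨c, d⟩ := e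
  obtain rfl : d = 0 := he
  exact N.lin_const σ c

theorem SymbolicNorm.norm_subst (N : SymbolicNorm L) (σ : Subst L) (t : L.Term ℕ) :
    N.norm (t.subst σ) = N.lin σ (N.norm t) := by
  induction t with
  | var x => simp [SymbolicNorm.norm, SymbolicNorm.lin_apply, Finsupp.sum_single_index]
  | func f ts ih => simp [SymbolicNorm.norm, ih, map_sum, SymbolicNorm.lin_const]

theorem SymbolicNorm.norm_nonneg (N : SymbolicNorm L) (t : L.Term ℕ) : 0 ≤ N.norm t := by
  induction t with
  | var x =>
    refine Prod.mk_le_mk.2 ⟨le_rfl, ?_⟩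
    exact Finsupp.single_nonneg.2 zero_le_one
  | func f ts ih =>
    refine add_nonneg (Prod.mk_le_mk.2 ⟨by positivity, le_rfl⟩) ?_
    refine Finset.sum_nonneg fun i _ => ?_
    rw [natCast_zsmul]
    exact nsmul_nonneg (ih i) _

theorem zsmul_nonneg_of_nonneg {e : LinExpr} {c : ℤ} (hc : 0 ≤ c) (he : 0 ≤ e) : 0 ≤ c • e := by
  lift c to ℕ using hc
  rw [natCast_zsmul]
  exact nsmul_nonneg he _

/-- Variables are replaced by nonnegative norms, so nonnegative coefficients can only add to the
constant term. This is why positive weights stay positive under instantiation. -/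
theorem SymbolicNorm.const_le_lin (N : SymbolicNorm L) (σ : Subst L) {e : LinExpr}
    (he : 0 ≤ e.2) : ((e.1, 0) : LinExpr) ≤ N.lin σ e := by
  rw [SymbolicNorm.lin_apply]
  refine le_add_of_nonneg_right (Finset.sum_nonneg fun v _ => ?_)
  exact zsmul_nonneg_of_nonneg (he v) (N.norm_nonneg _)

theorem SymbolicNorm.lin_nonneg (N : SymbolicNorm L) (σ : Subst L) {e : LinExpr}
    (he : 0 ≤ e) : 0 ≤ N.lin σ e :=
  le_trans (Prod.mk_le_mk.2 ⟨he.1, le_rfl⟩) (N.const_le_lin σ he.2)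

/-- If the value of a nonnegative expression is an integer, then so are the norms of the terms
substituted for its variables. -/
theorem SymbolicNorm.snd_eq_zero_of_lin (N : SymbolicNorm L) (σ : Subst L) {e : LinExpr}
    (he : 0 ≤ e) (h : (N.lin σ e).2 = 0) {x : ℕ} (hx : x ∈ e.2.support) :
    (N.norm (σ x)).2 = 0 := by
  rw [SymbolicNorm.lin_apply, Prod.snd_add, zero_add, Finsupp.sum, Prod.snd_sum] at h
  have h0 : ∀ v ∈ e.2.support, 0 ≤ (e.2 v • N.norm (σ v)).2 := fun v _ =>
    (zsmul_nonneg_of_nonneg (he.2 v) (N.norm_nonneg _)).2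
  have h1 := (Finset.sum_eq_zero_iff_of_nonneg h0).1 h x hx
  rw [Prod.smul_snd] at h1
  exact (smul_eq_zero.1 h1).resolve_left (Finsupp.mem_support_iff.1 hx)

/-- If all norms of the terms substituted for the variables of an expression are integers, then so
is its value. -/
theorem SymbolicNorm.lin_snd_eq_zero (N : SymbolicNorm L) (σ : Subst L) {e : LinExpr}
    (h : ∀ x ∈ e.2.support, (N.norm (σ x)).2 = 0) : (N.lin σ e).2 = 0 := by
  rw [SymbolicNorm.lin_apply, Prod.snd_add, zero_add, Finsupp.sum, Prod.snd_sum]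
  refine Finset.sum_eq_zero fun v hv => ?_
  rw [Prod.smul_snd, h v hv, smul_zero]

/-! ## Decrease of integer norms -/

/-- Both expressions are integers, and the second one is smaller. -/
def LinExpr.Decr (e e' : LinExpr) : Prop := e.2 = 0 ∧ e'.2 = 0 ∧ e'.1 < e.1

/-- The expressions are equal, or both are integers and the second one is smaller. -/
def LinExpr.DecrEq (e e' : LinExpr) : Prop := e = e' ∨ LinExpr.Decr e e'

theorem LinExpr.Decr.trans {a b c : LinExpr} (h : Decr a b) (h' : Decr b c) : Decr a c :=
  ⟨h.1, h'.2.1, h'.2.2.trans h.2.2⟩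

theorem LinExpr.Decr.trans_decrEq {a b c : LinExpr} (h : Decr a b) (h' : DecrEq b c) :
    Decr a c := by
  rcases h' with rfl | h'
  exacts [h, h.trans h']

theorem LinExpr.DecrEq.trans_decr {a b c : LinExpr} (h : DecrEq a b) (h' : Decr b c) :
    Decr a c := by
  rcases h with rfl | h
  exacts [h', h.trans h']

theorem LinExpr.DecrEq.trans {a b c : LinExpr} (h : DecrEq a b) (h' : DecrEq b c) :
    DecrEq a c := by
  rcases h' with rfl | h'
  exacts [h, .inr (h.trans_decr h')]

theorem LinExpr.Decr.irrefl {a : LinExpr} (h : Decr a a) : False := lt_irrefl _ h.2.2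

/-- Integers contain no variables, so instantiation leaves them alone. Arcs stay valid further down
a branch for this reason. -/
theorem LinExpr.Decr.lin (N : SymbolicNorm L) (σ : Subst L) {a b : LinExpr} (h : Decr a b) :
    Decr (N.lin σ a) (N.lin σ b) := by
  rwa [N.lin_of_snd_eq_zero σ h.1, N.lin_of_snd_eq_zero σ h.2.1]

namespace MixedGraph

variable {V W A B C : Type*}

/-! ## Soundness of mixed graphs -/

/-- What the graph says is true of the expressions `f x` at the nodes `x`. -/
structure SoundFor (G : MixedGraph V) (f : V → LinExpr) : Prop where
  black : ∀ x ∈ G.black, (f x).2 = 0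
  edges : ∀ x y, G.edges.Adj x y → f x = f y
  arcs : ∀ x y, G.arcs x y → LinExpr.Decr (f x) (f y)

theorem SoundFor.step {G : MixedGraph V} {f : V → LinExpr} (h : G.SoundFor f) {x y : V}
    (hxy : G.Step x y) : LinExpr.DecrEq (f x) (f y) :=
  hxy.imp (h.edges x y) (h.arcs x y)

theorem SoundFor.steps {G : MixedGraph V} {f : V → LinExpr} (h : G.SoundFor f) {x y : V}
    (hxy : Relation.ReflTransGen G.Step x y) : LinExpr.DecrEq (f x) (f y) := by
  induction hxy with
  | refl => exact .inl rfl
  | tail _ hs ih => exact ih.trans (h.step hs)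

/-- Going round a positive cycle would make an integer smaller than itself. -/
theorem SoundFor.consistent {G : MixedGraph V} {f : V → LinExpr} (h : G.SoundFor f) :
    G.Consistent := by
  rintro ⟨x, y, hxy, hyx⟩
  exact ((h.arcs x y hxy).trans_decrEq (h.steps hyx)).irrefl

theorem SoundFor.reachable {G : MixedGraph V} {f : V → LinExpr} (h : G.SoundFor f) {x y : V}
    (hxy : G.edges.Reachable x y) : f x = f y := by
  rw [SimpleGraph.reachable_iff_reflTransGen] at hxy
  induction hxy with
  | refl => rfl
  | tail _ hs ih => exact ih.trans (h.edges _ _ hs)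

theorem SoundFor.closure {G : MixedGraph V} {f : V → LinExpr} (h : G.SoundFor f) :
    G.closure.SoundFor f where
  black := by
    rintro x ⟨y, hy, hyx⟩
    rw [← h.reachable hyx]
    exact h.black y hy
  edges := by
    rintro x y ⟨-, hxy | hxy⟩
    exacts [h.reachable hxy, (h.reachable hxy).symm]
  arcs := by
    rintro x y ⟨x', y', hx, hxy, hy⟩
    exact ((h.steps hx).trans_decr (h.arcs _ _ hxy)).trans_decrEq (h.steps hy)

theorem SoundFor.restrict {G : MixedGraph V} {f : V → LinExpr} (h : G.SoundFor f) (g : W → V) :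
    (G.restrict g).SoundFor (f ∘ g) where
  black x hx := h.black (g x) hx
  edges x y hxy := h.edges (g x) (g y) hxy
  arcs x y hxy := h.arcs (g x) (g y) hxy

theorem SoundFor.lin {G : MixedGraph V} {f : V → LinExpr} (h : G.SoundFor f)
    (N : SymbolicNorm L) (σ : Subst L) : G.SoundFor (N.lin σ ∘ f) where
  black x hx := by
    rw [Function.comp_apply, N.lin_of_snd_eq_zero σ (h.black x hx)]
    exact h.black x hx
  edges x y hxy := congrArg (N.lin σ) (h.edges x y hxy)
  arcs x y hxy := (h.arcs x y hxy).lin N σ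

theorem SoundFor.of_subsumedBy {G H : MixedGraph V} {f : V → LinExpr} (h : G.SoundFor f)
    (hGH : G.SubsumedBy H) : H.SoundFor f where
  black x hx := h.black x (hGH.1 hx)
  edges x y hxy := h.edges x y (hGH.2.1 hxy)
  arcs x y hxy := h.arcs x y (hGH.2.2 x y hxy)

theorem SoundFor.glue {G : MixedGraph (A ⊕ B)} {H : MixedGraph (B ⊕ C)}
    {f : A ⊕ (B ⊕ C) → LinExpr} (hG : G.SoundFor (f ∘ Sum.map id Sum.inl))
    (hH : H.SoundFor (f ∘ Sum.inr)) : (glue G H).SoundFor f where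
  black := by
    rintro _ (⟨x, hx, rfl⟩ | ⟨x, hx, rfl⟩)
    exacts [hG.black x hx, hH.black x hx]
  edges := by
    rintro _ _ (⟨-, x, y, hxy, rfl, rfl⟩ | ⟨-, x, y, hxy, rfl, rfl⟩)
    exacts [hG.edges x y hxy, hH.edges x y hxy]
  arcs := by
    rintro _ _ (⟨x, y, hxy, rfl, rfl⟩ | ⟨x, y, hxy, rfl, rfl⟩)
    exacts [hG.arcs x y hxy, hH.arcs x y hxy]

/-! ## Transitively closed mixed graphs -/

/-- Arcs connect black nodes only. -/
def ArcsBlack (G : MixedGraph V) : Prop := ∀ x y, G.arcs x y → x ∈ G.black ∧ y ∈ G.black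

/-- The graph is transitively closed, and arcs connect black nodes only. -/
structure IsClosed (G : MixedGraph V) : Prop where
  arcsBlack : G.ArcsBlack
  black : ∀ x y, G.edges.Adj x y → x ∈ G.black → y ∈ G.black
  edges : ∀ x y z, G.edges.Adj x y → G.edges.Adj y z → x ≠ z → G.edges.Adj x z
  arcs : ∀ x y z, G.arcs x y → G.arcs y z → G.arcs x z
  arcs_edges : ∀ x y z, G.arcs x y → G.edges.Adj y z → G.arcs x z
  edges_arcs : ∀ x y z, G.edges.Adj x y → G.arcs y z → G.arcs x z

/-- Equality or adjacency. -/
def AdjEq (G : MixedGraph V) (x y : V) : Prop := x = y ∨ G.edges.Adj x y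

/-- Equality or a step. -/
def StepEq (G : MixedGraph V) (x y : V) : Prop := x = y ∨ G.Step x y

theorem IsClosed.adjEq_trans {G : MixedGraph V} (h : G.IsClosed) {x y z : V}
    (hxy : G.AdjEq x y) (hyz : G.AdjEq y z) : G.AdjEq x z := by
  rcases hxy with rfl | hxy
  · exact hyz
  rcases hyz with rfl | hyz
  · exact .inr hxy
  by_cases hxz : x = z
  exacts [.inl hxz, .inr (h.edges x y z hxy hyz hxz)]

theorem IsClosed.stepEq_trans {G : MixedGraph V} (h : G.IsClosed) {x y z : V}
    (hxy : G.StepEq x y) (hyz : G.StepEq y z) : G.StepEq x z := by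
  rcases hxy with rfl | hxy | hxy
  · exact hyz
  · rcases hyz with rfl | hyz | hyz
    · exact .inr (.inl hxy)
    · by_cases hxz : x = z
      exacts [.inl hxz, .inr (.inl (h.edges x y z hxy hyz hxz))]
    · exact .inr (.inr (h.edges_arcs _ _ _ hxy hyz))
  · rcases hyz with rfl | hyz | hyz
    · exact .inr (.inr hxy)
    · exact .inr (.inr (h.arcs_edges _ _ _ hxy hyz))
    · exact .inr (.inr (h.arcs _ _ _ hxy hyz))

theorem IsClosed.arcs_stepEq {G : MixedGraph V} (h : G.IsClosed) {x y z : V}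
    (hxy : G.arcs x y) (hyz : G.StepEq y z) : G.arcs x z := by
  rcases hyz with rfl | hyz | hyz
  exacts [hxy, h.arcs_edges _ _ _ hxy hyz, h.arcs _ _ _ hxy hyz]

theorem IsClosed.stepEq_arcs {G : MixedGraph V} (h : G.IsClosed) {x y z : V}
    (hxy : G.StepEq x y) (hyz : G.arcs y z) : G.arcs x z := by
  rcases hxy with rfl | hxy | hxy
  exacts [hyz, h.edges_arcs _ _ _ hxy hyz, h.arcs _ _ _ hxy hyz]

theorem IsClosed.restrict {G : MixedGraph V} (h : G.IsClosed) {g : W → V}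
    (hg : Function.Injective g) : (G.restrict g).IsClosed where
  arcsBlack x y hxy := h.arcsBlack (g x) (g y) hxy
  black x y := h.black (g x) (g y)
  edges x y z hxy hyz hxz := h.edges (g x) (g y) (g z) hxy hyz (hg.ne hxz)
  arcs x y z := h.arcs (g x) (g y) (g z)
  arcs_edges x y z := h.arcs_edges (g x) (g y) (g z)
  edges_arcs x y z := h.edges_arcs (g x) (g y) (g z)

theorem closure_adj {G : MixedGraph V} {x y : V} :
    G.closure.edges.Adj x y ↔ x ≠ y ∧ G.edges.Reachable x y :=
  and_congr_right fun _ => ⟨fun h => h.elim id .symm, .inl⟩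

theorem steps_of_reachable {G : MixedGraph V} {x y : V} (h : G.edges.Reachable x y) :
    Relation.ReflTransGen G.Step x y := by
  rw [SimpleGraph.reachable_iff_reflTransGen] at h
  exact Relation.ReflTransGen.mono (fun _ _ => .inl) _ _ h

/-- Edges transport blackness, and the source of an arc is black anyway. -/
theorem ArcsBlack.closure_black_of_steps {G : MixedGraph V} (h : G.ArcsBlack) {x y : V}
    (hxy : Relation.ReflTransGen G.Step x y) (hy : y ∈ G.closure.black) :
    x ∈ G.closure.black := by
  induction hxy using Relation.ReflTransGen.head_induction_on with
  | refl => exact hy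
  | head hs _ ih =>
    rcases hs with hs | hs
    · obtain ⟨z, hz, hzx⟩ := ih
      exact ⟨z, hz, hzx.trans hs.symm.reachable⟩
    · exact ⟨_, (h _ _ hs).1, .rfl⟩

theorem ArcsBlack.closure_black_of_steps' {G : MixedGraph V} (h : G.ArcsBlack) {x y : V}
    (hxy : Relation.ReflTransGen G.Step x y) (hx : x ∈ G.closure.black) :
    y ∈ G.closure.black := by
  induction hxy with
  | refl => exact hx
  | tail _ hs ih =>
    rcases hs with hs | hs
    · obtain ⟨z, hz, hzx⟩ := ih
      exact ⟨z, hz, hzx.trans hs.reachable⟩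
    · exact ⟨_, (h _ _ hs).2, .rfl⟩

theorem ArcsBlack.isClosed_closure {G : MixedGraph V} (h : G.ArcsBlack) :
    G.closure.IsClosed where
  arcsBlack := by
    rintro x y ⟨x', y', hx, hxy, hy⟩
    exact ⟨h.closure_black_of_steps hx ⟨x', (h _ _ hxy).1, .rfl⟩,
      h.closure_black_of_steps' hy ⟨y', (h _ _ hxy).2, .rfl⟩⟩
  black := by
    rintro x y hxy ⟨z, hz, hzx⟩
    exact ⟨z, hz, hzx.trans (closure_adj.1 hxy).2⟩
  edges x y z hxy hyz hxz :=
    closure_adj.2 ⟨hxz, (closure_adj.1 hxy).2.trans (closure_adj.1 hyz).2⟩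
  arcs := by
    rintro x y z ⟨x₁, y₁, hx₁, hxy₁, hy₁⟩ ⟨x₂, y₂, hx₂, hxy₂, hy₂⟩
    exact ⟨x₁, y₁, hx₁, hxy₁, (hy₁.trans hx₂).trans (.head (.inr hxy₂) hy₂)⟩
  arcs_edges := by
    rintro x y z ⟨x₁, y₁, hx₁, hxy₁, hy₁⟩ hyz
    exact ⟨x₁, y₁, hx₁, hxy₁, hy₁.trans (steps_of_reachable (closure_adj.1 hyz).2)⟩
  edges_arcs := by
    rintro x y z hxy ⟨x₁, y₁, hx₁, hxy₁, hy₁⟩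
    exact ⟨x₁, y₁, (steps_of_reachable (closure_adj.1 hxy).2).trans hx₁, hxy₁, hy₁⟩

theorem ArcsBlack.glue {G : MixedGraph (A ⊕ B)} {H : MixedGraph (B ⊕ C)} (hG : G.ArcsBlack)
    (hH : H.ArcsBlack) : (MixedGraph.glue G H).ArcsBlack := by
  rintro _ _ (⟨x, y, hxy, rfl, rfl⟩ | ⟨x, y, hxy, rfl, rfl⟩)
  · exact ⟨.inl ⟨x, (hG x y hxy).1, rfl⟩, .inl ⟨y, (hG x y hxy).2, rfl⟩⟩
  · exact ⟨.inr ⟨x, (hH x y hxy).1, rfl⟩, .inr ⟨y, (hH x y hxy).2, rfl⟩⟩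

/-! ## The range of a composition -/

/-- The identification of the nodes of the first of two glued graphs. -/
abbrev glueLeft : A ⊕ B → A ⊕ (B ⊕ C) := Sum.map id Sum.inl

theorem glueLeft_injective : Function.Injective (glueLeft : A ⊕ B → A ⊕ (B ⊕ C)) :=
  Sum.map_injective.2 ⟨Function.injective_id, Sum.inl_injective⟩

theorem glueLeft_eq_inr {w : A ⊕ B} {c : B ⊕ C} (h : glueLeft w = Sum.inr c) :
    ∃ b, w = Sum.inr b ∧ c = Sum.inl b := by
  rcases w with a | b
  · simp at h
  · exact ⟨b, rfl, (Sum.inr_injective h).symm⟩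

/-- A path in two glued transitive relations that starts in the second one can be shortened. -/
theorem glue_path {R : A ⊕ B → A ⊕ B → Prop} {S : B ⊕ C → B ⊕ C → Prop}
    (hRr : ∀ x, R x x) (hSr : ∀ x, S x x)
    (hRt : ∀ {x y z}, R x y → R y z → R x z) (hSt : ∀ {x y z}, S x y → S y z → S x z)
    (hRS : ∀ b b' : B, R (.inr b) (.inr b') → S (.inl b) (.inl b'))
    {x : B ⊕ C} {z : A ⊕ (B ⊕ C)}
    (h : Relation.ReflTransGen (fun u v => Relation.Map R glueLeft glueLeft u v ∨
      Relation.Map S Sum.inr Sum.inr u v) (.inr x) z) :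
    (∀ c, z = .inr c → S x c) ∧
      ∀ w, z = glueLeft w → ∃ b, S x (.inl b) ∧ R (.inr b) w := by
  -- The two conjuncts form the invariant; a common node satisfies both. An excursion into the first
  -- graph that returns to a common node amounts to one `R`-step between common nodes, which `hRS`
  -- turns into an `S`-step.
  induction h with
  | refl =>
    refine ⟨fun c hc => ?_, fun w hw => ?_⟩
    · cases hc
      exact hSr x
    · obtain ⟨b, rfl, rfl⟩ := glueLeft_eq_inr hw.symm
      exact ⟨b, hSr _, hRr _⟩
  | tail _ hs ih =>
    rcases hs with ⟨w, w', hww, rfl, rfl⟩ | ⟨c, c', hcc, rfl, rfl⟩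
    · obtain ⟨b, hb, hbw⟩ := ih.2 w rfl
      refine ⟨fun c hc => ?_, fun w'' hw => ?_⟩
      · obtain ⟨b', rfl, rfl⟩ := glueLeft_eq_inr hc
        exact hSt hb (hRS _ _ (hRt hbw hww))
      · obtain rfl := glueLeft_injective hw
        exact ⟨b, hb, hRt hbw hww⟩
    · have hxc := hSt (ih.1 c rfl) hcc
      refine ⟨fun c'' hc => ?_, fun w hw => ?_⟩
      · cases hc
        exact hxc
      · obtain ⟨b, rfl, rfl⟩ := glueLeft_eq_inr hw.symm
        exact ⟨b, hxc, hRr _⟩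

theorem AdjEq.symm {G : MixedGraph V} {x y : V} (h : G.AdjEq x y) : G.AdjEq y x :=
  h.imp Eq.symm SimpleGraph.Adj.symm

theorem IsClosed.adjEq_black {G : MixedGraph V} (h : G.IsClosed) {x y : V}
    (hxy : G.AdjEq x y) (hx : x ∈ G.black) : y ∈ G.black := by
  rcases hxy with rfl | hxy
  exacts [hx, h.black x y hxy hx]

section Glue

variable {G : MixedGraph (A ⊕ B)} {H : MixedGraph (B ⊕ C)}

theorem glue_reachable (hG : G.IsClosed) (hH : H.IsClosed)
    (hGH : (H.restrict Sum.inl).SubsumedBy (G.restrict Sum.inr)) {x : B ⊕ C} {z : A ⊕ (B ⊕ C)}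
    (h : (glue G H).edges.Reachable (.inr x) z) :
    (∀ c, z = .inr c → H.AdjEq x c) ∧
      ∀ w, z = glueLeft w → ∃ b, H.AdjEq x (.inl b) ∧ G.AdjEq (.inr b) w := by
  rw [SimpleGraph.reachable_iff_reflTransGen] at h
  refine glue_path (R := G.AdjEq) (S := H.AdjEq)
    (fun _ => .inl rfl) (fun _ => .inl rfl) hG.adjEq_trans hH.adjEq_trans
    ?_ (Relation.ReflTransGen.mono ?_ _ _ h)
  · rintro b b' (h | h)
    · exact .inl (by cases h; rfl)
    · exact .inr (hGH.2.1 h)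
  · rintro _ _ (⟨-, x, y, hxy, rfl, rfl⟩ | ⟨-, x, y, hxy, rfl, rfl⟩)
    exacts [.inl ⟨x, y, .inr hxy, rfl, rfl⟩, .inr ⟨x, y, .inr hxy, rfl, rfl⟩]

theorem stepEq_of_stepEq (hGH : (H.restrict Sum.inl).SubsumedBy (G.restrict Sum.inr))
    (b b' : B) (h : G.StepEq (.inr b) (.inr b')) :
    H.StepEq (.inl b) (.inl b') := by
  rcases h with h | h | h
  · exact .inl (by cases h; rfl)
  · exact .inr (.inl (hGH.2.1 h))
  · exact .inr (.inr (hGH.2.2 _ _ h))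

theorem glue_steps (hG : G.IsClosed) (hH : H.IsClosed)
    (hGH : (H.restrict Sum.inl).SubsumedBy (G.restrict Sum.inr)) {x : B ⊕ C} {z : A ⊕ (B ⊕ C)}
    (h : Relation.ReflTransGen (glue G H).Step (.inr x) z) :
    (∀ c, z = .inr c → H.StepEq x c) ∧
      ∀ w, z = glueLeft w → ∃ b, H.StepEq x (.inl b) ∧ G.StepEq (.inr b) w := by
  refine glue_path (R := G.StepEq) (S := H.StepEq)
    (fun _ => .inl rfl) (fun _ => .inl rfl) hG.stepEq_trans hH.stepEq_trans
    (stepEq_of_stepEq hGH) (Relation.ReflTransGen.mono ?_ _ _ h)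
  rintro _ _ ((⟨-, x, y, hxy, rfl, rfl⟩ | ⟨-, x, y, hxy, rfl, rfl⟩) |
    (⟨x, y, hxy, rfl, rfl⟩ | ⟨x, y, hxy, rfl, rfl⟩))
  exacts [.inl ⟨x, y, .inr (.inl hxy), rfl, rfl⟩, .inr ⟨x, y, .inr (.inl hxy), rfl, rfl⟩,
    .inl ⟨x, y, .inr (.inr hxy), rfl, rfl⟩, .inr ⟨x, y, .inr (.inr hxy), rfl, rfl⟩]

/-- Reversing both relations turns paths that end in the second graph into paths that start there.
-/
theorem glue_steps_swap (hG : G.IsClosed) (hH : H.IsClosed)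
    (hGH : (H.restrict Sum.inl).SubsumedBy (G.restrict Sum.inr)) {x : B ⊕ C} {z : A ⊕ (B ⊕ C)}
    (h : Relation.ReflTransGen (glue G H).Step z (.inr x)) :
    (∀ c, z = .inr c → H.StepEq c x) ∧
      ∀ w, z = glueLeft w → ∃ b, H.StepEq (.inl b) x ∧ G.StepEq w (.inr b) := by
  refine glue_path (R := Function.swap G.StepEq) (S := Function.swap H.StepEq)
    (fun _ => .inl rfl) (fun _ => .inl rfl)
    (fun h h' => hG.stepEq_trans h' h) (fun h h' => hH.stepEq_trans h' h)
    (fun b b' => stepEq_of_stepEq hGH b' b)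
    (Relation.ReflTransGen.mono ?_ _ _ (Relation.reflTransGen_swap.2 h))
  rintro _ _ ((⟨-, x, y, hxy, rfl, rfl⟩ | ⟨-, x, y, hxy, rfl, rfl⟩) |
    (⟨x, y, hxy, rfl, rfl⟩ | ⟨x, y, hxy, rfl, rfl⟩))
  exacts [.inl ⟨y, x, .inr (.inl hxy), rfl, rfl⟩, .inr ⟨y, x, .inr (.inl hxy), rfl, rfl⟩,
    .inl ⟨y, x, .inr (.inr hxy), rfl, rfl⟩, .inr ⟨y, x, .inr (.inr hxy), rfl, rfl⟩]

/-- Composition does not add anything to the second of two closed graphs if what the first one says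
about their common nodes is known in the second one. -/
theorem restrict_closure_glue (hG : G.IsClosed) (hH : H.IsClosed)
    (hGH : (H.restrict Sum.inl).SubsumedBy (G.restrict Sum.inr)) :
    (glue G H).closure.restrict Sum.inr = H := by
  refine MixedGraph.ext ?_ ?_ ?_
  · ext x
    refine ⟨?_, fun hx => ⟨_, .inr ⟨x, hx, rfl⟩, .rfl⟩⟩
    rintro ⟨_, ⟨w, hw, rfl⟩ | ⟨y, hy, rfl⟩, hyx⟩
    · obtain ⟨b, hb, hbw⟩ := (glue_reachable hG hH hGH hyx.symm).2 w rfl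
      have hb' : b ∈ (H.restrict Sum.inl).black := hGH.1 (hG.adjEq_black hbw.symm hw)
      exact hH.adjEq_black hb.symm hb'
    · exact hH.adjEq_black ((glue_reachable hG hH hGH hyx.symm).1 y rfl).symm hy
  · ext x y
    refine ⟨fun h => ?_, fun h => ?_⟩
    · obtain ⟨hne, hr⟩ := closure_adj.1
        (show (glue G H).closure.edges.Adj (.inr x) (.inr y) from h)
      rcases (glue_reachable hG hH hGH hr).1 y rfl with rfl | h
      exacts [(hne rfl).elim, h]
    · refine closure_adj.2 ⟨Sum.inr_injective.ne h.ne, SimpleGraph.Adj.reachable ?_⟩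
      exact .inr ⟨Sum.inr_injective.ne h.ne, x, y, h, rfl, rfl⟩
  · ext x y
    refine ⟨?_, fun h => ⟨_, _, .refl, .inr ⟨x, y, h, rfl, rfl⟩, .refl⟩⟩
    rintro ⟨_, _, hx, ⟨u, v, huv, rfl, rfl⟩ | ⟨u, v, huv, rfl, rfl⟩, hy⟩
    -- The arc lies in the first graph, but both ends of the path lie in the second. So the path
    -- enters through `b` and leaves through `b'`, and the part between is an arc of `G` on common
    -- nodes, which `H` knows.
    · obtain ⟨b, hb, hbu⟩ := (glue_steps hG hH hGH hx).2 u rfl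
      obtain ⟨b', hb', hbv⟩ := (glue_steps_swap hG hH hGH hy).2 v rfl
      have h : (H.restrict Sum.inl).arcs b b' :=
        hGH.2.2 _ _ (hG.arcs_stepEq (hG.stepEq_arcs hbu huv) hbv)
      exact hH.arcs_stepEq (hH.stepEq_arcs hb h) hb'
    · exact hH.arcs_stepEq (hH.stepEq_arcs ((glue_steps hG hH hGH hx).1 u rfl) huv)
        ((glue_steps_swap hG hH hGH hy).1 v rfl)

end Glue

/-! ### Finiteness of the set of mixed graphs on finitely many nodes. -/

theorem toProd_injective : Function.Injective fun G : MixedGraph V =>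
    ((G.black, G.edges, G.arcs) : Set V × SimpleGraph V × (V → V → Prop)) := by
  intro G H h
  simp only [Prod.mk.injEq] at h
  exact MixedGraph.ext h.1 h.2.1 h.2.2

instance [Finite V] : Finite (MixedGraph V) := .of_injective _ toProd_injective

end MixedGraph

/-! ## Augmented argument mappings -/

section Augmented

variable {N : SymbolicNorm L} {C : Clause L} {s : Fin C.body.length} {π : Query C.head.pred}
  {info : (k : Fin C.body.length) → AnswerInfo (C.body.get k).pred.arity}

theorem Derives.trans {x y z : AugNode C s} {e e' : LinExpr} {n n' : ℕ}
    (h : Derives N C s π info x y e n) (h' : Derives N C s π info y z e' n') :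
    Derives N C s π info x z (e + e') (n + n') := by
  induction h' with
  | refl => simpa using h
  | edge _ hs ih => exact ih.edge hs
  | arc _ hs ih => exact ih.arc hs
  | forward _ hs ih => rw [← add_assoc]; exact ih.forward hs
  | backward _ hs ih => rw [← add_sub_assoc]; exact ih.backward hs

theorem Derives.of_baseEdge {x y : AugNode C s}
    (h : BaseEdge N C s π info x y ∨ BaseEdge N C s π info y x) :
    Derives N C s π info x y 0 0 :=
  (Derives.refl x).edge h

/-- Edges are undirected and weighted arcs may be traversed both ways with opposite signs; only
unweighted arcs, excluded by `hn`, are irreversible. -/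
theorem Derives.symm {x y : AugNode C s} {e : LinExpr} {n : ℕ}
    (h : Derives N C s π info x y e n) (hn : n = 0) : Derives N C s π info y x (-e) 0 := by
  induction h with
  | refl => rw [neg_zero]; exact .refl _
  | edge _ hs ih => simpa using (Derives.of_baseEdge hs.symm).trans (ih hn)
  | arc => omega
  | @forward y z e w n _ hs ih =>
    have := ((Derives.refl z).backward hs).trans (ih hn)
    simpa [add_comm] using this
  | @backward y z e w n _ hs ih =>
    have := ((Derives.refl z).forward hs).trans (ih hn)
    simpa [add_comm, sub_eq_add_neg] using this

theorem augmentedMapping_adj {x y : AugNode C s} :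
    (augmentedMapping N C s π info).edges.Adj x y ↔ x ≠ y ∧ Derives N C s π info x y 0 0 :=
  and_congr_right fun _ => ⟨fun h => h.elim id fun h => by simpa using h.symm rfl, .inl⟩

theorem LinExpr.Pos.add {e e' : LinExpr} (h : Pos e) (h' : Pos e') : Pos (e + e') :=
  ⟨fun x => add_nonneg (h.1 x) (h'.1 x), add_pos h.2 h'.2⟩

theorem augmentedMapping_isClosed : (augmentedMapping N C s π info).IsClosed where
  arcsBlack x y h := ⟨h.1, h.2.1⟩
  black x y h hx := .edge x y hx (augmentedMapping_adj.1 h).2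
  edges x y z h h' hxz := augmentedMapping_adj.2
    ⟨hxz, by simpa using (augmentedMapping_adj.1 h).2.trans (augmentedMapping_adj.1 h').2⟩
  arcs := by
    rintro x y z ⟨hx, -, e, n, h, hp⟩ ⟨-, hz, e', n', h', hp'⟩
    refine ⟨hx, hz, e + e', n + n', h.trans h', ?_⟩
    have heq : e + e' + (((n + n' : ℕ) : ℤ), 0) = (e + ((n : ℤ), 0)) + (e' + ((n' : ℤ), 0)) := by
      have : ((((n + n' : ℕ) : ℤ), 0) : LinExpr) = ((n : ℤ), 0) + ((n' : ℤ), 0) := by simp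
      rw [this]
      abel
    rw [heq]
    exact hp.add hp'
  arcs_edges := by
    rintro x y z ⟨hx, hy, e, n, h, hp⟩ h'
    refine ⟨hx, .edge y z hy (augmentedMapping_adj.1 h').2, e, n, ?_, hp⟩
    simpa using h.trans (augmentedMapping_adj.1 h').2
  edges_arcs := by
    rintro x y z h' ⟨hx, hy, e, n, h, hp⟩
    have h₀ := (augmentedMapping_adj.1 h').2
    refine ⟨.edge y x hx (by simpa using h₀.symm rfl), hy, e, n, ?_, hp⟩
    simpa using h₀.trans h

theorem ofArg_injective (C : Clause L) (s : Fin C.body.length) :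
    Function.Injective (AugNode.ofArg C s) := by
  rintro (i | i) (j | j) h
  all_goals have h := congrArg Subtype.val h; simp only [AugNode.ofArg] at h
  · rw [RuleNode.head.inj h]
  · cases h
  · cases h
  · rw [eq_of_heq (RuleNode.body.inj h).2]

/-- If the arcs of the query connect black nodes, then the query is contained in the augmented
argument mapping. -/
theorem summary_restrict_subsumedBy (hπ : π.ArcsBlack) :
    ((summary N C s π info).restrict Sum.inl).SubsumedBy π := by
  refine ⟨fun i hi => .query i hi, fun i j hij => ?_, fun i j hij => ?_⟩
  · refine augmentedMapping_adj.2 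
      ⟨fun h => hij.ne (Sum.inl_injective (ofArg_injective C s h)),
        .of_baseEdge (.inl (.query i j hij))⟩
  -- The witness is the arc by itself: weight `0`, one arc, total `1`.
  · refine ⟨.query i (hπ i j hij).1, .query j (hπ i j hij).2, 0, 1,
      (Derives.refl _).arc (.query i j hij), fun x => ?_, ?_⟩ <;> simp

theorem summary_isClosed : (summary N C s π info).IsClosed :=
  augmentedMapping_isClosed.restrict (ofArg_injective C s)

/-! ### Soundness of the augmented argument mapping under a substitution that makes its data true.
-/

section Sound

variable {σ : Subst L}

theorem BaseEdge.sound
    (hπ : π.SoundFor fun i => N.lin σ (N.norm (C.head.args i)))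
    (hinfo : ∀ k < s, AnswerInfo.Describes N ((C.body.get k).subst σ) (info k))
    {x y : AugNode C s} (h : BaseEdge N C s π info x y) :
    N.lin σ (N.norm x.1.term) = N.lin σ (N.norm y.1.term) := by
  cases h with
  | rule _ _ h =>
    rcases h with ⟨-, h | h⟩
    exacts [congrArg _ h, congrArg _ h.symm]
  | query i j h => exact hπ.edges i j h
  | answer k hk i j h =>
    have h : N.norm (((C.body.get k).args i).subst σ) = N.norm (((C.body.get k).args j).subst σ) :=
      (hinfo k hk).2.2.1 i j h
    rwa [N.norm_subst, N.norm_subst] at h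

theorem BaseArc.sound
    (hπ : π.SoundFor fun i => N.lin σ (N.norm (C.head.args i)))
    (hinfo : ∀ k < s, AnswerInfo.Describes N ((C.body.get k).subst σ) (info k))
    {x y : AugNode C s} (h : BaseArc C s π info x y) :
    ((1, 0) : LinExpr) ≤ N.lin σ (N.norm x.1.term) - N.lin σ (N.norm y.1.term) := by
  cases h with
  | query i j h =>
    obtain ⟨hi, hj, hij⟩ := hπ.arcs i j h
    refine Prod.mk_le_mk.2 ⟨?_, ?_⟩
    · exact Int.le_sub_left_of_add_le (Int.add_one_le_iff.2 hij)
    · exact ((sub_eq_zero.2 (hi.trans hj.symm)).ge)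
  | answer k hk i j h =>
    have h : LinExpr.Pos (N.norm (((C.body.get k).args i).subst σ) -
      N.norm (((C.body.get k).args j).subst σ)) := (hinfo k hk).2.2.2 i j h
    rw [N.norm_subst, N.norm_subst] at h
    exact Prod.mk_le_mk.2 ⟨h.2, h.1⟩

/-- Here `d` is the sum of the differences along the arcs and inequalities of the path, each with
constant term at least `1` and nonnegative coefficients. Weights are differences of norms and
therefore telescope. -/
theorem Derives.sound
    (hπ : π.SoundFor fun i => N.lin σ (N.norm (C.head.args i)))
    (hinfo : ∀ k < s, AnswerInfo.Describes N ((C.body.get k).subst σ) (info k))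
    {x y : AugNode C s} {e : LinExpr} {n : ℕ} (h : Derives N C s π info x y e n) :
    ∃ d : LinExpr, (((n : ℤ), 0) : LinExpr) ≤ d ∧ (n = 0 → d = 0) ∧
      N.lin σ (N.norm x.1.term) = N.lin σ (N.norm y.1.term) + N.lin σ e + d := by
  induction h with
  | refl => exact ⟨0, le_rfl, fun _ => rfl, by simp⟩
  | edge _ hs ih =>
    obtain ⟨d, hd, hd', hx⟩ := ih
    refine ⟨d, hd, hd', hx.trans ?_⟩
    rcases hs with hs | hs
    · rw [hs.sound hπ hinfo]
    · rw [hs.sound hπ hinfo]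
  | @arc y z e n _ hs ih =>
    obtain ⟨d, hd, hd', hx⟩ := ih
    refine ⟨d + (N.lin σ (N.norm y.1.term) - N.lin σ (N.norm z.1.term)), ?_,
      fun h => by omega, ?_⟩
    · have := add_le_add hd (hs.sound hπ hinfo)
      simpa using this
    · rw [hx]
      abel
  | forward _ hs ih =>
    obtain ⟨d, hd, hd', hx⟩ := ih
    refine ⟨d, hd, hd', hx.trans ?_⟩
    rw [map_add, hs.1, map_sub]
    abel
  | backward _ hs ih =>
    obtain ⟨d, hd, hd', hx⟩ := ih
    refine ⟨d, hd, hd', hx.trans ?_⟩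
    rw [map_sub, hs.1, map_sub]
    abel

theorem Derives.sound_eq
    (hπ : π.SoundFor fun i => N.lin σ (N.norm (C.head.args i)))
    (hinfo : ∀ k < s, AnswerInfo.Describes N ((C.body.get k).subst σ) (info k))
    {x y : AugNode C s} (h : Derives N C s π info x y 0 0) :
    N.lin σ (N.norm x.1.term) = N.lin σ (N.norm y.1.term) := by
  obtain ⟨d, -, hd, h⟩ := h.sound hπ hinfo
  simpa [hd rfl] using h

theorem Black.sound
    (hπ : π.SoundFor fun i => N.lin σ (N.norm (C.head.args i)))
    (hinfo : ∀ k < s, AnswerInfo.Describes N ((C.body.get k).subst σ) (info k))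
    {x : AugNode C s} (h : Black N C s π info x) : (N.lin σ (N.norm x.1.term)).2 = 0 := by
  induction h with
  | query i hi => exact hπ.black i hi
  | answer k hk i hi =>
    have : (N.norm (((C.body.get k).args i).subst σ)).2 = 0 := (hinfo k hk).1 i hi
    rwa [N.norm_subst] at this
  | rule x y _ h ih =>
    -- Norms have nonnegative coefficients, so nothing cancels: if the instantiated norm of a black
    -- node is an integer, then so is the norm of the term substituted for each of its variables.
    exact N.lin_snd_eq_zero σ fun v hv =>
      N.snd_eq_zero_of_lin σ (N.norm_nonneg _) (ih v hv) (h v hv)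
  | edge x y _ h ih => rwa [← h.sound_eq hπ hinfo]

theorem augmentedMapping_soundFor
    (hπ : π.SoundFor fun i => N.lin σ (N.norm (C.head.args i)))
    (hinfo : ∀ k < s, AnswerInfo.Describes N ((C.body.get k).subst σ) (info k)) :
    (augmentedMapping N C s π info).SoundFor fun x => N.lin σ (N.norm x.1.term) where
  black x hx := Black.sound hπ hinfo hx
  edges x y hxy := (augmentedMapping_adj.1 hxy).2.sound_eq hπ hinfo
  arcs := by
    rintro x y ⟨hx, hy, e, n, h, hp⟩
    refine ⟨hx.sound hπ hinfo, hy.sound hπ hinfo, ?_⟩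
    -- Both norms are integers, so comparing constant terms suffices: that of the instantiated `e`
    -- is at least the original one, and that of `d` is at least `n`.
    obtain ⟨d, hd, -, h⟩ := h.sound hπ hinfo
    have h0 : 0 ≤ e.2 := fun v => by simpa using hp.1 v
    have h1 := (N.const_le_lin σ h0).1
    have h2 := hd.1
    have h3 := hp.2
    simp only [Prod.fst_add] at h1 h2 h3
    rw [h]
    simp only [Prod.fst_add]
    omega

/-- A black node has integer norm, which a true disjunct cannot list as not instantiated enough. -/
theorem augConsistent_of_sound
    (hπ : π.SoundFor fun i => N.lin σ (N.norm (C.head.args i)))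
    (hinfo : ∀ k < s, AnswerInfo.Describes N ((C.body.get k).subst σ) (info k)) :
    AugConsistent N C s π info := by
  refine ⟨(augmentedMapping_soundFor hπ hinfo).consistent, fun k hk i hi hb => ?_⟩
  refine (hinfo k hk).2.1 i hi ?_
  change (N.norm (((C.body.get k).args i).subst σ)).2 = 0
  rw [N.norm_subst]
  exact hb.sound hπ hinfo

end Sound

end Augmented

/-! ## Substitutions -/

theorem term_subst_subst (t : L.Term ℕ) (σ τ : Subst L) :
    (t.subst σ).subst τ = t.subst (σ.comp τ) := by
  induction t with
  | var x => rfl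
  | func f ts ih => simp [ih]

theorem Atom.subst_subst (A : Atom L) (σ τ : Subst L) :
    (A.subst σ).subst τ = A.subst (σ.comp τ) := by
  simp [Atom.subst, term_subst_subst]

theorem GoalAtom.subst_subst (x : GoalAtom P) (σ τ : Subst L) :
    (x.subst σ).subst τ = x.subst (σ.comp τ) := by
  simp [GoalAtom.subst, Atom.subst_subst]

theorem term_subst_var (t : L.Term ℕ) : t.subst (fun x => Term.var x) = t := by
  induction t with
  | var x => rfl
  | func f ts ih => simp [ih]

theorem Atom.subst_var (A : Atom L) : A.subst (fun x => Term.var x) = A := by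
  simp [Atom.subst, term_subst_var]

theorem GoalAtom.subst_var (x : GoalAtom P) : x.subst (fun x => Term.var x) = x := by
  simp [GoalAtom.subst, Atom.subst_var]

theorem Subst.comp_assoc (σ τ υ : Subst L) : (σ.comp τ).comp υ = σ.comp (τ.comp υ) := by
  funext x
  exact term_subst_subst _ _ _

theorem Subst.comp_var (σ : Subst L) : σ.comp (fun x => Term.var x) = σ := by
  funext x
  exact term_subst_var _

/-! ## Paths in LD-trees -/

namespace LDTree

variable (T : LDTree P Q)

theorem along_append (a l l' : Addr P) :
    T.along a (l' ++ l) = (T.along a l).comp (T.along (l ++ a) l') := by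
  induction l' with
  | nil => exact (Subst.comp_var _).symm
  | cons i l' ih =>
    simp only [List.cons_append, LDTree.along, ih, List.append_assoc, Subst.comp_assoc]

variable {T}

theorem mem_of_append_mem {a l : Addr P} (h : l ++ a ∈ T.nodes) : a ∈ T.nodes := by
  induction l with
  | nil => exact h
  | cons i l ih => exact ih ((T.mem_cons_iff _ i).1 h).1

theorem mem_of_suffix {a b : Addr P} (hb : b ∈ T.nodes) (h : a <:+ b) : a ∈ T.nodes := by
  obtain ⟨l, rfl⟩ := h
  exact mem_of_append_mem hb

theorem exists_goal_of_cons_mem {a : Addr P} {i : Fin P.length} (h : i :: a ∈ T.nodes) :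
    ∃ x rest, T.goal a = x :: rest ∧
      x.atom.subst (T.mgu a i) =
        ((P.get i).head.subst (renameVars L (T.ren a i))).subst (T.mgu a i) ∧
      T.goal (i :: a) = resolvent P a i (T.ren a i) (T.mgu a i) rest := by
  obtain ⟨-, x, rest, hx, -⟩ := (T.mem_cons_iff a i).1 h
  exact ⟨x, rest, hx, (T.isMGU a i h x rest hx).1, T.goal_cons a i h x rest hx⟩

theorem mem_resolvent {a : Addr P} {i : Fin P.length} {ρ : Equiv.Perm ℕ} {θ : Subst L}
    {rest : List (GoalAtom P)} {y : GoalAtom P} (h : y ∈ resolvent P a i ρ θ rest) :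
    (∃ s, y = ⟨(((P.get i).body.get s).subst (renameVars L ρ)).subst θ, some ⟨a, i, s⟩⟩) ∨
      ∃ x ∈ rest, y = x.subst θ := by
  simp only [resolvent, List.mem_map, List.mem_append, List.mem_finRange, true_and] at h
  obtain ⟨_, ⟨s, rfl⟩ | hx, rfl⟩ := h
  exacts [.inl ⟨s, rfl⟩, .inr ⟨_, hx, rfl⟩]

theorem origin_suffix {b : Addr P} (hb : b ∈ T.nodes) {x : GoalAtom P} (hx : x ∈ T.goal b)
    {o : Origin P} (ho : x.origin = some o) : o.rule :: o.node <:+ b := by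
  induction b generalizing x with
  | nil =>
    rw [T.goal_root, List.mem_map] at hx
    obtain ⟨A, -, rfl⟩ := hx
    simp at ho
  | cons i a ih =>
    obtain ⟨y, rest, hy, -, hg⟩ := exists_goal_of_cons_mem hb
    rw [hg] at hx
    obtain ⟨s, rfl⟩ | ⟨z, hz, rfl⟩ := mem_resolvent hx
    · obtain rfl := Option.some.inj ho
      exact List.suffix_rfl
    · exact (ih (x := z) (mem_of_append_mem (l := [i]) hb)
          (by rw [hy]; exact List.mem_cons_of_mem _ hz) ho).trans
        (List.suffix_cons i a)

/-- How the goal at a node `l ++ c` arises from the goal at the node `c`: the first `j` atoms of the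
latter have been resolved, and have led to the atoms in `E`. -/
theorem exists_goal_append {c l : Addr P} (h : l ++ c ∈ T.nodes) :
    ∃ (E : List (GoalAtom P)) (j : ℕ), j ≤ (T.goal c).length ∧
      T.goal (l ++ c) = E ++ ((T.goal c).drop j).map (fun x => x.subst (T.along c l)) ∧
      (∀ e ∈ E, ∃ o, e.origin = some o ∧ c.length ≤ o.node.length) ∧
      (∀ τ : Subst L, (∀ e ∈ E, Success P (e.atom.subst τ)) → ∀ k < j, ∀ g,
        (T.goal c)[k]? = some g → Success P ((g.atom.subst (T.along c l)).subst τ)) ∧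
      (E = [] ∨ ∃ l', l' <:+ l ∧ l' ≠ l ∧
        (T.goal (l' ++ c)).length ≤ (T.goal c).length - j + 1) := by
  induction l with
  | nil =>
    refine ⟨[], 0, Nat.zero_le _, ?_, by simp, fun τ _ k hk => by omega, .inl rfl⟩
    simp [LDTree.along, GoalAtom.subst_var]
  | cons i l ih =>
    obtain ⟨E, j, hj, hgoal, horig, hsucc, hlen⟩ := ih (mem_of_append_mem (l := [i]) h)
    obtain ⟨x, rest, hx, hunif, hres⟩ := exists_goal_of_cons_mem (a := l ++ c) h
    set ρ := T.ren (l ++ c) i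
    set η := T.mgu (l ++ c) i
    -- Once unified, the selected atom is an instance of the head, so it succeeds whenever the
    -- corresponding body instances do.
    have hsuccx : ∀ τ : Subst L, (∀ s, Success P (((((P.get i).body.get s).subst
        (renameVars L ρ)).subst η).subst τ)) → Success P ((x.atom.subst η).subst τ) := by
      intro τ hτ
      rw [hunif, Atom.subst_subst, Atom.subst_subst]
      refine .intro (P.get i) (List.get_mem P i) _ fun B hB => ?_
      obtain ⟨s, rfl⟩ := List.get_of_mem hB
      have := hτ s
      rwa [Atom.subst_subst, Atom.subst_subst] at this
    let body : List (GoalAtom P) := (List.finRange (P.get i).body.length).map fun s =>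
      ⟨(((P.get i).body.get s).subst (renameVars L ρ)).subst η, some ⟨l ++ c, i, s⟩⟩
    have hbody : T.goal (i :: l ++ c) = body ++ rest.map (fun y => y.subst η) := by
      refine hres.trans ?_
      simp only [resolvent, List.map_append, List.map_map, body]
      rfl
    have hbody_mem : ∀ s, (⟨(((P.get i).body.get s).subst (renameVars L ρ)).subst η,
        some ⟨l ++ c, i, s⟩⟩ : GoalAtom P) ∈ body := fun s =>
      List.mem_map.2 ⟨s, List.mem_finRange s, rfl⟩
    have hbody_orig : ∀ e ∈ body, ∃ o, e.origin = some o ∧ c.length ≤ o.node.length := by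
      intro e he
      obtain ⟨s, -, rfl⟩ := List.mem_map.1 he
      exact ⟨_, rfl, by simp⟩
    have hcomp : (fun y : GoalAtom P => y.subst (T.along c (i :: l))) =
        (fun y => y.subst η) ∘ fun y => y.subst (T.along c l) := by
      funext y
      exact (GoalAtom.subst_subst y _ _).symm
    have hcompA : ∀ A : Atom L, A.subst (T.along c (i :: l)) = (A.subst (T.along c l)).subst η :=
      fun A => (Atom.subst_subst A _ _).symm
    -- If `E` is empty, the step resolves atom number `j` of the goal at `c`, and `j` grows by one.
    -- Otherwise it resolves the first atom of `E`, and `j` stays.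
    rcases E with _ | ⟨e, E⟩
    · rw [List.nil_append] at hgoal
      have hjlt : j < (T.goal c).length := by
        by_contra hcon
        rw [List.drop_of_length_le (by omega)] at hgoal
        rw [hgoal] at hx
        simp at hx
      have hdrop := List.drop_eq_getElem_cons hjlt
      rw [hgoal, hdrop, List.map_cons] at hx
      obtain ⟨hx1, hx2⟩ := List.cons.inj hx
      refine ⟨body, j + 1, hjlt, ?_, hbody_orig, fun τ hτ k hk g hg => ?_, .inr
        ⟨l, List.suffix_cons i l, by simp, ?_⟩⟩
      · rw [hbody, ← hx2, hcomp, List.map_map]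
      · rw [hcompA]
        rcases Nat.lt_succ_iff_lt_or_eq.1 hk with hk | rfl
        · rw [Atom.subst_subst]
          exact hsucc _ (by simp) k hk g hg
        · rw [List.getElem?_eq_getElem hjlt] at hg
          obtain rfl := Option.some.inj hg
          have hxa : x.atom = ((T.goal c)[k].atom).subst (T.along c l) := by rw [← hx1]; rfl
          rw [← hxa]
          exact hsuccx τ fun s => hτ _ (hbody_mem s)
      -- At `l ++ c` exactly `j` atoms are gone, so its length is that of the goal at `c` minus `j +
      -- 1`, plus `1`.
      · rw [hgoal]
        simp
        omega
    · rw [hgoal, List.cons_append] at hx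
      obtain ⟨rfl, hx2⟩ := List.cons.inj hx
      refine ⟨body ++ E.map (fun y => y.subst η), j, hj, ?_, ?_, fun τ hτ k hk g hg => ?_, .inr ?_⟩
      · rw [hbody, ← hx2, hcomp, List.map_append, List.map_map, List.append_assoc]
      · intro e' he'
        rcases List.mem_append.1 he' with he' | he'
        · exact hbody_orig e' he'
        · obtain ⟨y, hy, rfl⟩ := List.mem_map.1 he'
          exact horig y (List.mem_cons_of_mem _ hy)
      · rw [hcompA, Atom.subst_subst]
        refine hsucc _ (fun y hy => ?_) k hk g hg
        rw [← Atom.subst_subst]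
        rcases List.mem_cons.1 hy with rfl | hy
        · exact hsuccx τ fun s => hτ _ (List.mem_append_left _ (hbody_mem s))
        · exact hτ _ (List.mem_append_right _ (List.mem_map.2 ⟨y, hy, rfl⟩))
      · obtain ⟨l', hl', -, hle⟩ := hlen.resolve_left (by simp)
        refine ⟨l', hl'.trans (List.suffix_cons i l), ?_, hle⟩
        rintro rfl
        have := hl'.length_le
        simp at this

theorem getElem?_resolvent {a : Addr P} {i : Fin P.length} {ρ : Equiv.Perm ℕ} {θ : Subst L}
    {rest : List (GoalAtom P)} (s : Fin (P.get i).body.length) :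
    (resolvent P a i ρ θ rest)[(s : ℕ)]? =
      some ⟨(((P.get i).body.get s).subst (renameVars L ρ)).subst θ, some ⟨a, i, s⟩⟩ := by
  have h : (s : ℕ) < ((List.finRange (P.get i).body.length).map fun s =>
    (⟨((P.get i).body.get s).subst (renameVars L ρ), some ⟨a, i, s⟩⟩ : GoalAtom P)).length := by
    simp
  rw [resolvent, List.getElem?_map, List.getElem?_append_left h, List.getElem?_eq_getElem h,
    List.getElem_map, List.getElem_finRange]
  rfl

theorem length_resolvent (a : Addr P) (i : Fin P.length) (ρ : Equiv.Perm ℕ) (θ : Subst L)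
    (rest : List (GoalAtom P)) :
    (resolvent P a i ρ θ rest).length = (P.get i).body.length + rest.length := by
  simp [resolvent]

/-- The first atom of a direct offspring, and the success of the subgoals that precede it. -/
theorem DirectOffspring.exists_along {a b : Addr P} {i : Fin P.length}
    {s : Fin (P.get i).body.length} (h : T.DirectOffspring a b i s) :
    ∃ l, b = l ++ a ∧
      (∃ x rest, T.goal a = x :: rest ∧ x.atom.subst (T.along a l) =
        ((P.get i).head.subst (renameVars L (T.ren a i))).subst (T.along a l)) ∧
      (∃ y rest, T.goal b = y :: rest ∧ y.atom =
        (((P.get i).body.get s).subst (renameVars L (T.ren a i))).subst (T.along a l)) ∧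
      ∀ k < s, Success P
        ((((P.get i).body.get k).subst (renameVars L (T.ren a i))).subst (T.along a l)) := by
  obtain ⟨hb, y, rest', hy, ho⟩ := h
  obtain ⟨l, rfl⟩ := origin_suffix hb (hy ▸ List.mem_cons_self) ho
  dsimp only at *
  have hia := mem_of_append_mem hb
  obtain ⟨x, rest, hx, hunif, hres⟩ := exists_goal_of_cons_mem hia
  have halong : T.along a (l ++ [i]) = (T.mgu a i).comp (T.along (i :: a) l) :=
    T.along_append a [i] l
  obtain ⟨E, j, hj, hgoal, horig, hsucc, -⟩ := exists_goal_append hb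
  -- An atom of `E` would originate at or below `i :: a`, but the first atom of the goal originates
  -- at `a`.
  have hE : E = [] := by
    rcases E with _ | ⟨e, E⟩
    · rfl
    rw [hy, List.cons_append] at hgoal
    obtain ⟨rfl, -⟩ := List.cons.inj hgoal
    obtain ⟨o, ho', hlen⟩ := horig y List.mem_cons_self
    obtain rfl := Option.some.inj (ho.symm.trans ho')
    simp at hlen
  subst hE
  rw [List.nil_append] at hgoal
  have hjlt : j < (T.goal (i :: a)).length := by
    by_contra hcon
    rw [List.drop_of_length_le (by omega), hy] at hgoal
    simp at hgoal
  rw [List.drop_eq_getElem_cons hjlt, List.map_cons, hy] at hgoal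
  obtain ⟨rfl, -⟩ := List.cons.inj hgoal
  have hjs : j = s := by
    by_cases hjr : j < (P.get i).body.length
    · have h1 := getElem?_resolvent (a := a) (ρ := T.ren a i) (θ := T.mgu a i) (rest := rest)
        ⟨j, hjr⟩
      rw [← hres, List.getElem?_eq_getElem hjlt] at h1
      have h2 := congrArg GoalAtom.origin (Option.some.inj h1)
      have h3 := Option.some.inj (h2.symm.trans ho)
      have h4 := congrArg (fun o : Origin P => (o.sub : ℕ)) h3
      exact h4
    -- Otherwise the first atom would descend from the rest of the goal at `a`, whose atoms all
    -- originate strictly above `a`.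
    · exfalso
      have hmem : (T.goal (i :: a))[j] ∈ rest.map fun y => y.subst (T.mgu a i) := by
        have h1 : (T.goal (i :: a))[j]? =
            (rest.map fun y => y.subst (T.mgu a i))[j - (P.get i).body.length]? := by
          rw [hres, resolvent, List.map_append, List.getElem?_append_right (by simpa using hjr)]
          simp
        rw [List.getElem?_eq_getElem hjlt] at h1
        exact List.mem_of_getElem? h1.symm
      obtain ⟨z, hz, hzeq⟩ := List.mem_map.1 hmem
      have hzo : z.origin = some ⟨a, i, s⟩ :=
        (congrArg GoalAtom.origin hzeq :
          (z.subst (T.mgu a i)).origin = _).trans ho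
      have := origin_suffix (mem_of_append_mem (l := [i]) hia)
        (hx ▸ List.mem_cons_of_mem _ hz) hzo
      have := this.length_le
      simp at this
  subst hjs
  refine ⟨l ++ [i], by simp, ⟨x, rest, hx, ?_⟩, ⟨_, rest', hy, ?_⟩, fun k hk => ?_⟩
  · rw [halong, ← Atom.subst_subst, hunif, ← Atom.subst_subst]
  · have h1 := getElem?_resolvent (a := a) (ρ := T.ren a i) (θ := T.mgu a i) (rest := rest) s
    rw [← hres, List.getElem?_eq_getElem hjlt] at h1
    rw [Option.some.inj h1, halong, ← Atom.subst_subst]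
    rfl
  · have h1 := getElem?_resolvent (a := a) (ρ := T.ren a i) (θ := T.mgu a i) (rest := rest) k
    rw [← hres] at h1
    -- No atoms remain in `E`, so the identity substitution already gives success of the earlier
    -- subgoals.
    have h2 := hsucc (fun x => Term.var x) (by simp) k hk _ h1
    rw [Atom.subst_var] at h2
    rwa [halong, ← Atom.subst_subst]

/-! ## Infinite branches -/

/-- The step of König's lemma: a node below `a` is `a` itself or lies below one of finitely many
children. -/
theorem exists_infinite_extensions {a : Addr P} (h : {b ∈ T.nodes | a <:+ b}.Infinite) :
    ∃ i : Fin P.length, {b ∈ T.nodes | i :: a <:+ b}.Infinite := by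
  by_contra! hcon
  refine h (((Set.finite_singleton a).union (Set.finite_iUnion fun i => hcon i)).subset ?_)
  rintro b ⟨hb, l, rfl⟩
  rcases List.eq_nil_or_concat l with rfl | ⟨l, i, rfl⟩
  · exact .inl rfl
  · exact .inr (Set.mem_iUnion.2 ⟨i, hb, l, by simp⟩)

/-- An infinite LD-tree has an infinite branch. -/
theorem exists_infinite_branch (h : T.nodes.Infinite) :
    ∃ c : ℕ → Addr P, (∀ n, ∃ i, c (n + 1) = i :: c n) ∧ (∀ n, (c n).length = n) ∧
      ∀ n, c n ∈ T.nodes := by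
  obtain ⟨i₀, -⟩ := exists_infinite_extensions (T := T) (a := []) (by simpa using h)
  have : Nonempty (Fin P.length) := ⟨i₀⟩
  choose! f hf using fun a => exists_infinite_extensions (T := T) (a := a)
  let c : ℕ → Addr P := fun n => Nat.rec [] (fun _ a => f a :: a) n
  have hc : ∀ n, {b ∈ T.nodes | c n <:+ b}.Infinite := by
    intro n
    induction n with
    | zero => simpa [c] using h
    | succ n ih => exact hf _ ih
  refine ⟨c, fun n => ⟨f (c n), rfl⟩, fun n => ?_, fun n => ?_⟩
  · induction n with
    | zero => rfl
    | succ n ih => simpa [c] using ih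
  · obtain ⟨b, hb, hcb⟩ := (hc n).nonempty
    exact mem_of_suffix hb hcb

theorem branch_suffix {c : ℕ → Addr P} (hc : ∀ n, ∃ i, c (n + 1) = i :: c n) {m n : ℕ}
    (h : m ≤ n) : c m <:+ c n := by
  induction n, h using Nat.le_induction with
  | base => exact List.suffix_rfl
  | succ n _ ih =>
    obtain ⟨i, hi⟩ := hc n
    exact hi ▸ ih.trans (List.suffix_cons i _)

theorem exists_first_argmin (f : ℕ → ℕ) (n : ℕ) :
    ∃ m, n ≤ m ∧ (∀ k, n ≤ k → f m ≤ f k) ∧ ∀ k, n ≤ k → k < m → f m < f k := by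
  have hex : ∃ m, n ≤ m ∧ ∀ k, n ≤ k → f m ≤ f k := by
    obtain ⟨m, hm, hmin⟩ := (measure f).wf.has_min {m | n ≤ m} ⟨n, le_refl n⟩
    exact ⟨m, hm, fun k hk => not_lt.1 (hmin k hk)⟩
  classical
  obtain ⟨h1, h2⟩ := Nat.find_spec hex
  refine ⟨Nat.find hex, h1, h2, fun k hk hlt => (h2 k hk).lt_of_ne fun heq => ?_⟩
  exact Nat.find_min hex hlt ⟨hk, fun k' hk' => heq ▸ h2 k' hk'⟩

/-- If no goal further down an infinite branch is shorter than the goal at a node, then this node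
has a direct offspring of the same kind on the branch. -/
theorem exists_directOffspring_branch {c : ℕ → Addr P} (hc : ∀ n, ∃ i, c (n + 1) = i :: c n)
    (hlen : ∀ n, (c n).length = n) (hmem : ∀ n, c n ∈ T.nodes) {n : ℕ}
    (hn : ∀ m, n ≤ m → (T.goal (c n)).length ≤ (T.goal (c m)).length) :
    ∃ n', (∀ m, n' ≤ m → (T.goal (c n')).length ≤ (T.goal (c m)).length) ∧
      ∃ i s, T.DirectOffspring (c n) (c n') i s := by
  -- The next call is the first position after `n` at which the goal length is minimal from there
  -- on.
  obtain ⟨n', hnn, hmin, hfirst⟩ := exists_first_argmin (fun m => (T.goal (c m)).length) (n + 1)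
  refine ⟨n', fun m hm => hmin m (hnn.trans hm), ?_⟩
  obtain ⟨i, hi⟩ := hc n
  obtain ⟨l, hl⟩ := branch_suffix hc hnn
  obtain ⟨x, rest, hx, -, hres⟩ := exists_goal_of_cons_mem (hi ▸ hmem (n + 1))
  rw [← hi] at hres
  obtain ⟨E, j, hj, hgoal, -, -, hE⟩ := exists_goal_append (l := l) (c := c (n + 1))
    (hl ▸ hmem n')
  rw [hl] at hgoal
  have hn' := hn n' (by omega)
  -- With `E` nonempty, the goal at `c n'` would be at least as long as one strictly between `n + 1`
  -- (inclusive) and `n'`, against the choice of the first minimum.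
  have hE' : E = [] := by
    by_contra hne
    obtain ⟨l', hl', hne', hle⟩ := hE.resolve_left hne
    have hlt : l'.length < l.length := lt_of_le_of_ne hl'.length_le fun h => hne' (hl'.eq_of_length h)
    have hll : l.length + (n + 1) = n' := by
      have := congrArg List.length hl
      rwa [List.length_append, hlen, hlen] at this
    have heq : l' ++ c (n + 1) = c (n + 1 + l'.length) := by
      have h1 : l' ++ c (n + 1) <:+ c n' := by
        obtain ⟨l'', rfl⟩ := hl'
        exact ⟨l'', by rw [← hl, List.append_assoc]⟩
      have h2 : c (n + 1 + l'.length) <:+ c n' := branch_suffix hc (by omega)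
      refine (List.suffix_of_suffix_length_le h1 h2 ?_).eq_of_length ?_ <;>
        simp only [List.length_append, hlen] <;> omega
    have := hfirst (n + 1 + l'.length) (by omega) (by omega)
    rw [← heq] at this
    have hpos : 0 < E.length := List.length_pos_iff.2 hne
    rw [hgoal] at this
    simp only [List.length_append, List.length_map, List.length_drop] at this
    omega
  subst hE'
  rw [List.nil_append] at hgoal
  have hlen' := congrArg List.length hgoal
  rw [List.length_map, List.length_drop, hres, length_resolvent] at hlen'
  rw [hx, List.length_cons] at hn'
  -- The goal at `c n'` is longer than `rest`, so a body atom of the rule is still there to be its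
  -- first atom.
  have hjr : j < (P.get i).body.length := by omega
  have hjlt : j < (T.goal (c (n + 1))).length := by
    rw [hres, length_resolvent]
    omega
  refine ⟨i, ⟨j, hjr⟩, hmem n', ?_⟩
  rw [List.drop_eq_getElem_cons hjlt, List.map_cons] at hgoal
  refine ⟨_, _, hgoal, ?_⟩
  have h1 := getElem?_resolvent (a := c n) (ρ := T.ren (c n) i) (θ := T.mgu (c n) i)
    (rest := rest) ⟨j, hjr⟩
  rw [← hres, List.getElem?_eq_getElem hjlt] at h1
  rw [Option.some.inj h1]
  rfl

/-- In an infinite LD-tree there is an infinite sequence of nodes each of which is a direct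
offspring of the preceding one. -/
theorem exists_offspring_sequence (h : T.nodes.Infinite) :
    ∃ c : ℕ → Addr P, ∀ n, ∃ i s, T.DirectOffspring (c n) (c (n + 1)) i s := by
  obtain ⟨c, hc, hlen, hmem⟩ := exists_infinite_branch h
  let M := {n : ℕ // ∀ m, n ≤ m → (T.goal (c n)).length ≤ (T.goal (c m)).length}
  obtain ⟨n₀, -, hn₀, -⟩ := exists_first_argmin (fun m => (T.goal (c m)).length) 0
  have hnext : ∀ n : M, ∃ n' : M, ∃ i s, T.DirectOffspring (c n.1) (c n'.1) i s := by
    intro n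
    obtain ⟨n', hn', hd⟩ := exists_directOffspring_branch hc hlen hmem n.2
    exact ⟨⟨n', hn'⟩, hd⟩
  choose f hf using hnext
  refine ⟨fun n => c (f^[n] ⟨n₀, fun m _ => hn₀ m (Nat.zero_le m)⟩).1, fun n => ?_⟩
  beta_reduce
  rw [Function.iterate_succ_apply']
  exact hf _

end LDTree

/-! ## Infinite descent along a forward positive cycle -/

theorem SymbolicNorm.lin_comp (N : SymbolicNorm L) (σ τ : Subst L) (e : LinExpr) :
    N.lin (σ.comp τ) e = N.lin τ (N.lin σ e) := by
  rw [N.lin_apply, N.lin_apply σ, map_add, N.lin_const, map_finsuppSum]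
  refine congrArg₂ _ rfl (Finsupp.sum_congr fun v _ => ?_)
  rw [map_smul, ← N.norm_subst]
  rfl

/-- The value of an expression under the substitutions `σ k, …, σ (k + d - 1)`. -/
def SymbolicNorm.iterLin (N : SymbolicNorm L) (σ : ℕ → Subst L) : ℕ → ℕ → LinExpr → LinExpr
  | 0, _, e => e
  | d + 1, k, e => SymbolicNorm.iterLin N σ d (k + 1) (N.lin (σ k) e)

theorem SymbolicNorm.iterLin_const (N : SymbolicNorm L) (σ : ℕ → Subst L) (d k : ℕ)
    {e : LinExpr} (he : e.2 = 0) : N.iterLin σ d k e = e := by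
  induction d generalizing k with
  | zero => rfl
  | succ d ih => rw [SymbolicNorm.iterLin, N.lin_of_snd_eq_zero _ he, ih]

theorem SymbolicNorm.iterLin_nonneg (N : SymbolicNorm L) (σ : ℕ → Subst L) (d k : ℕ)
    {e : LinExpr} (he : 0 ≤ e) : 0 ≤ N.iterLin σ d k e := by
  induction d generalizing k e with
  | zero => exact he
  | succ d ih => exact ih _ (N.lin_nonneg _ he)

theorem SymbolicNorm.iterLin_succ (N : SymbolicNorm L) (σ : ℕ → Subst L) (d k : ℕ)
    (e : LinExpr) : N.iterLin σ (d + 1) k e = N.lin (σ (k + d)) (N.iterLin σ d k e) := by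
  induction d generalizing k e with
  | zero => rfl
  | succ d ih =>
    rw [SymbolicNorm.iterLin, ih, Nat.add_right_comm]
    rfl

theorem SymbolicNorm.iterLin_eq_of_const (N : SymbolicNorm L) (σ : ℕ → Subst L) (d d' k : ℕ)
    {e : LinExpr} (he : (N.iterLin σ d k e).2 = 0) :
    N.iterLin σ (d' + d) k e = N.iterLin σ d k e := by
  induction d' with
  | zero => rw [zero_add]
  | succ d' ih => rw [Nat.add_right_comm, N.iterLin_succ, ih, N.lin_of_snd_eq_zero _ he]

theorem LinExpr.Decr.iterLin {N : SymbolicNorm L} {σ : ℕ → Subst L} {d k : ℕ} {e e' : LinExpr}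
    (h : Decr e e') : Decr (N.iterLin σ d k e) (N.iterLin σ d k e') := by
  rwa [N.iterLin_const _ _ _ h.1, N.iterLin_const _ _ _ h.2.1]

theorem LinExpr.DecrEq.iterLin {N : SymbolicNorm L} {σ : ℕ → Subst L} {d k : ℕ} {e e' : LinExpr}
    (h : DecrEq e e') : DecrEq (N.iterLin σ d k e) (N.iterLin σ d k e') := by
  rcases h with rfl | h
  exacts [.inl rfl, .inr h.iterLin]

section Descent

variable {N : SymbolicNorm L} {p : Pred L} {A : QMPair p p} {u : ℕ → Fin p.arity → LinExpr}
  {σ : ℕ → Subst L}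

/-- The norms at the nodes of the `k`-th copy of a mapping. -/
def copyNorms (N : SymbolicNorm L) (u : ℕ → Fin p.arity → LinExpr) (σ : ℕ → Subst L) (k : ℕ) :
    Fin p.arity ⊕ Fin p.arity → LinExpr :=
  Sum.elim (fun i => N.lin (σ k) (u k i)) (u (k + 1))

/-- The number `m` counts the circular edges on the path. Each moves to the next copy, whose domain
is already instantiated by its own substitution, so one substitution fewer remains to be applied on
the right. -/
theorem decrEq_of_circularSteps (hs : ∀ k, A.map.SoundFor (copyNorms N u σ k))
    {x y : Fin p.arity ⊕ Fin p.arity} (h : Relation.ReflTransGen A.CircularStep x y) :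
    ∃ m, ∀ k d, LinExpr.DecrEq (N.iterLin σ (d + m) (k + 1) (copyNorms N u σ k x))
      (N.iterLin σ d (k + m + 1) (copyNorms N u σ (k + m) y)) := by
  induction h with
  | refl => exact ⟨0, fun k d => .inl rfl⟩
  | tail _ hstep ih =>
    obtain ⟨m, hm⟩ := ih
    rcases hstep with hstep | ⟨i, rfl, rfl⟩
    · exact ⟨m, fun k d => (hm k d).trans ((hs _).step hstep).iterLin⟩
    · refine ⟨m + 1, fun k d => ?_⟩
      have := hm k (d + 1)
      rwa [Nat.add_right_comm] at this

theorem not_hasForwardPositiveCycle (hu : ∀ k i, 0 ≤ u k i)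
    (hs : ∀ k, A.map.SoundFor (copyNorms N u σ k)) : ¬ A.HasForwardPositiveCycle := by
  rintro ⟨x, y, hxy, hyx⟩
  obtain ⟨m, hm⟩ := decrEq_of_circularSteps hs hyx
  have hdecr : ∀ k d, LinExpr.Decr (N.iterLin σ (d + m) (k + 1) (copyNorms N u σ k x))
      (N.iterLin σ d (k + m + 1) (copyNorms N u σ (k + m) x)) := fun k d =>
    ((hs k).arcs x y hxy).iterLin.trans_decrEq (hm k d)
  have hnonneg : ∀ k, 0 ≤ copyNorms N u σ k x := by
    rcases x with i | i <;> intro k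
    exacts [N.lin_nonneg _ (hu _ _), hu _ _]
  -- After `M` turns the value is still nonnegative and each turn lost at least `1`, so at the start
  -- it was at least `M`. The case `m = 0` needs no separate treatment.
  have hlower : ∀ M k : ℕ, (M : ℤ) ≤ (N.iterLin σ (M * m) (k + 1) (copyNorms N u σ k x)).1 := by
    intro M
    induction M with
    | zero => exact fun k => by simpa using (N.iterLin_nonneg σ (0 * m) (k + 1) (hnonneg k)).1
    | succ M ih =>
      intro k
      have h1 := (hdecr k (M * m)).2.2
      have h2 := ih (k + m)
      rw [Nat.succ_mul]
      push_cast
      omega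
  -- After `m` substitutions the value is an integer and stays fixed, so all the lower bounds apply
  -- to one number.
  have hconst := fun d => N.iterLin_eq_of_const σ m d 1 (e := copyNorms N u σ 0 x)
    (by simpa using (hdecr 0 0).1)
  have h := hlower ((N.iterLin σ m 1 (copyNorms N u σ 0 x)).1.toNat + 1) 0
  rw [Nat.succ_mul, zero_add, hconst] at h
  push_cast at h
  have := Int.self_le_toNat (N.iterLin σ m 1 (copyNorms N u σ 0 x)).1
  omega

end Descent

/-! ## Ramsey's theorem for pairs -/

/-- Fix a nonprincipal ultrafilter. Each `i` has a colour `f i` shared by almost all pairs `(i, j)`,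
and almost all `i` have the same `f i`. Indices can then be picked one by one, since finitely many
large sets meet. -/
theorem exists_homogeneous_subsequence {K : Type*} (col : ℕ → ℕ → K) {F : Set K} (hF : F.Finite)
    (hcol : ∀ i j, i < j → col i j ∈ F) :
    ∃ (k : K) (g : ℕ → ℕ), StrictMono g ∧ ∀ m n, m < n → col (g m) (g n) = k := by
  let U : Ultrafilter ℕ := Filter.hyperfilter ℕ
  have hU : ∀ i, ∀ᶠ j in (U : Filter ℕ), i < j := fun i =>
    Filter.Eventually.filter_mono (Nat.hyperfilter_le_atTop) (Filter.eventually_gt_atTop i)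
  have h1 : ∀ i, ∃ k ∈ F, ∀ᶠ j in (U : Filter ℕ), col i j = k := fun i => by
    refine (Ultrafilter.eventually_exists_mem_iff hF).1 ((hU i).mono fun j hj => ?_)
    exact ⟨_, hcol i j hj, rfl⟩
  choose f hfF hf using h1
  obtain ⟨k, -, hk⟩ : ∃ k ∈ F, ∀ᶠ i in (U : Filter ℕ), f i = k :=
    (Ultrafilter.eventually_exists_mem_iff hF).1 (.of_forall fun i => ⟨_, hfF i, rfl⟩)
  obtain ⟨g, hg, hgr⟩ := exists_seq_of_forall_finset_exists (fun i => f i = k)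
    (fun i j => i < j ∧ col i j = k) fun s hs => by
      have hall : ∀ᶠ j in (U : Filter ℕ), ∀ i ∈ s, i < j ∧ col i j = k :=
        (Filter.eventually_all_finset s).2 fun i hi => by
          have := hf i
          rw [hs i hi] at this
          exact (hU i).and this
      exact (hk.and hall).exists
  exact ⟨k, g, fun m n h => (hgr m n h).1, fun m n h => (hgr m n h).2⟩

/-! ## Norms of the arguments of an atom -/

/-- The norms of the arguments of an atom, indexed by all natural numbers. -/
def Atom.val (N : SymbolicNorm L) (A : Atom L) (i : ℕ) : LinExpr :=
  if h : i < A.pred.arity then N.norm (A.args ⟨i, h⟩) else 0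

/-- Indexing by natural numbers allows unified atoms to be compared without transport along an
equality of arities. -/
theorem Atom.val_fin (N : SymbolicNorm L) (A : Atom L) (i : Fin A.pred.arity) :
    A.val N i = N.norm (A.args i) := dif_pos i.2

theorem Atom.val_subst (N : SymbolicNorm L) (A : Atom L) (σ : Subst L) (i : ℕ) :
    (A.subst σ).val N i = N.lin σ (A.val N i) := by
  by_cases h : i < A.pred.arity
  · have h1 : A.val N i = N.norm (A.args ⟨i, h⟩) := dif_pos h
    have h2 : (A.subst σ).val N i = N.norm ((A.args ⟨i, h⟩).subst σ) := dif_pos h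
    rw [h1, h2, N.norm_subst]
  · have h1 : A.val N i = 0 := dif_neg h
    have h2 : (A.subst σ).val N i = 0 := dif_neg h
    rw [h1, h2, map_zero]

theorem Atom.val_nonneg (N : SymbolicNorm L) (A : Atom L) (i : ℕ) : 0 ≤ A.val N i := by
  unfold Atom.val
  split
  exacts [N.norm_nonneg _, le_rfl]

theorem absQuery_soundFor (N : SymbolicNorm L) (A : Atom L) :
    (absQuery N A).SoundFor fun i => A.val N i := by
  simp only [Atom.val_fin]
  refine ⟨fun i hi => hi, ?_, fun i j h => h⟩
  rintro i j ⟨-, h | h⟩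
  exacts [h, h.symm]

theorem AnswerInfo.describes_subst_subst {N : SymbolicNorm L} {A : Atom L} {σ τ : Subst L}
    {d : AnswerInfo A.pred.arity} :
    AnswerInfo.Describes N ((A.subst σ).subst τ) d ↔
      AnswerInfo.Describes N (A.subst (σ.comp τ)) d := by
  simp only [AnswerInfo.Describes, Atom.subst, term_subst_subst]
  rfl

/-! ## Calls and the links between them -/

/-- A node, the first atom of its goal, and a query for it. -/
structure Call (P : Program L) where
  addr : Addr P
  atom : Atom L
  query : Σ p : Pred L, Query p

/-- The predicates that occur in a program. -/
def predicates (P : Program L) : Set (Pred L) :=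
  {p | ∃ C ∈ P, p = C.head.pred ∨ ∃ B ∈ C.body, p = B.pred}

theorem predicates_finite (P : Program L) : (predicates P).Finite := by
  have h : predicates P ⊆ ⋃ C ∈ {C | C ∈ P}, ({C.head.pred} ∪ Atom.pred '' {B | B ∈ C.body}) := by
    rintro p ⟨C, hC, rfl | ⟨B, hB, rfl⟩⟩
    · exact Set.mem_biUnion (x := C) hC (.inl rfl)
    · exact Set.mem_biUnion (x := C) hC (.inr ⟨B, hB, rfl⟩)
  exact ((List.finite_toSet P).biUnion fun C _ =>
    (Set.finite_singleton _).union ((List.finite_toSet C.body).image _)).subset h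

/-- Query-mapping pairs for arbitrary predicates. -/
abbrev AnyPair (L : FirstOrder.Language.{u, v}) := Σ (p : Pred L) (q : Pred L), QMPair p q

instance (p q : Pred L) : Finite (QMPair p q) :=
  .of_injective (fun A => (A.query, A.map)) fun A B h => by
    cases A
    cases B
    simpa using h

theorem anyPair_finite (P : Program L) :
    {C : AnyPair L | C.1 ∈ predicates P ∧ C.2.1 ∈ predicates P}.Finite := by
  refine ((predicates_finite P).biUnion fun p _ => (predicates_finite P).biUnion fun q _ =>
    Set.finite_range fun A : QMPair p q => (⟨p, q, A⟩ : AnyPair L)).subset ?_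
  rintro ⟨p, q, A⟩ ⟨hp, hq⟩
  exact Set.mem_biUnion hp (Set.mem_biUnion hq ⟨A, rfl⟩)

/-! ### Query-mapping pairs between calls: existence, soundness and composition. -/

section Links

variable (N : SymbolicNorm L) (T : LDTree P Q) (init : (b : Addr P) → (p : Pred L) → Query p)
  (ch : DisjunctChoice P)

/-- The first atom and the query of the call are those of its node, and the query is sound. -/
structure Call.Valid (S : Call P) : Prop where
  goal : ∃ y rest, T.goal S.addr = y :: rest ∧ y.atom = S.atom
  app : AppQuery N T init ch S.addr S.query.1 S.query.2
  pred_eq : S.query.1 = S.atom.pred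
  sound : S.query.2.SoundFor fun i => S.atom.val N i

/-- The query-mapping pair `C` is assigned to the branch between two calls, and it is sound and
transitively closed. -/
structure Link (S S' : Call P) (C : AnyPair L) : Prop where
  alpha : AlphaApp N T init ch S.addr S'.addr C.1 C.2.1 C.2.2
  mem : C.1 ∈ predicates P ∧ C.2.1 ∈ predicates P
  query : S.query = ⟨C.1, C.2.2.query⟩
  range : S'.query = ⟨C.2.1, Mapping.range C.2.2.map⟩
  closed : C.2.2.map.IsClosed
  domain : C.2.2.query.ArcsBlack → (C.2.2.map.restrict Sum.inl).SubsumedBy C.2.2.query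
  sound : ∃ σ : Subst L, C.2.2.map.SoundFor
    (Sum.elim (fun i => N.lin σ (S.atom.val N i)) fun i => S'.atom.val N i)

variable {N T init ch}

/-- Along the branch the call and the renamed head become equal, so the sound query of the call is
sound for the head under `σ`. The preceding subgoals have succeeded, so their disjuncts are true.
Soundness then gives consistency, hence the pair, and a sound query for the offspring. -/
theorem Call.Valid.exists_link {tab : AnswerTable L} (htab : tab.Sound N P)
    (hch : ch.Fits N T tab) {S : Call P} (hS : S.Valid N T init ch) {b : Addr P}
    {i : Fin P.length} {s : Fin (P.get i).body.length} (hd : T.DirectOffspring S.addr b i s) :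
    ∃ S' : Call P, S'.addr = b ∧ S'.Valid N T init ch ∧ ∃ C, Link N T init ch S S' C := by
  obtain ⟨a, x, p, π⟩ := S
  obtain ⟨⟨x', rest, hx, rfl⟩, happ, hp, hsound⟩ := hS
  dsimp only at *
  obtain ⟨l, rfl, ⟨x, rest', hx', hunif⟩, ⟨y, rest'', hy, hyatom⟩, hsucc⟩ := hd.exists_along
  obtain ⟨rfl, -⟩ := List.cons.inj (hx.symm.trans hx')
  have hpred : x'.atom.pred = (P.get i).head.pred :=
    (congrArg Atom.pred hunif : (x'.atom.subst (T.along a l)).pred = _)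
  obtain rfl := hp.trans hpred
  rw [Atom.subst_subst] at hunif hyatom
  set σ := (renameVars L (T.ren a i)).comp (T.along a l) with hσ
  have hhead : ∀ j : Fin (P.get i).head.pred.arity,
      N.lin σ (N.norm ((P.get i).head.args j)) = N.lin (T.along a l) (x'.atom.val N j) := fun j => by
    rw [← Atom.val_fin, ← Atom.val_subst, ← Atom.val_subst, hunif]
  have hbody : ∀ j : Fin ((P.get i).body.get s).pred.arity,
      N.lin σ (N.norm (((P.get i).body.get s).args j)) = y.atom.val N j := fun j => by
    rw [← Atom.val_fin, ← Atom.val_subst, hyatom]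
  have hπ : π.SoundFor fun j => N.lin σ (N.norm ((P.get i).head.args j)) := by
    simp only [hhead]
    exact hsound.lin N (T.along a l)
  have hinfo : ∀ k < s, AnswerInfo.Describes N (((P.get i).body.get k).subst σ)
      (ch (l ++ a) i k) := fun k hk =>
    AnswerInfo.describes_subst_subst.1 (hch a l i s hd k hk (htab _ (hsucc k hk))).2
  have hcons := augConsistent_of_sound hπ hinfo
  have hsum := (augmentedMapping_soundFor hπ hinfo).restrict (AugNode.ofArg (P.get i) s)
  have hval : ((fun z : AugNode (P.get i) s => N.lin σ (N.norm z.1.term)) ∘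
      AugNode.ofArg (P.get i) s) = Sum.elim
        (fun j : Fin (P.get i).head.pred.arity => N.lin (T.along a l) (x'.atom.val N j))
        fun j : Fin ((P.get i).body.get s).pred.arity => y.atom.val N j := by
    funext z
    rcases z with j | j
    exacts [hhead j, hbody j]
  rw [hval] at hsum
  refine ⟨⟨l ++ a, y.atom, ⟨((P.get i).body.get s).pred,
    Mapping.range (summary N (P.get i) s π (ch (l ++ a) i))⟩⟩, rfl,
    ⟨⟨y, rest'', hy, rfl⟩, .call a _ i s π hd happ hcons, ?_, hsum.restrict Sum.inr⟩,
    ⟨_, _, ⟨π, summary N (P.get i) s π (ch (l ++ a) i)⟩⟩, .direct a _ i s π hd happ hcons,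
    ⟨⟨_, List.get_mem P i, .inl rfl⟩, ⟨_, List.get_mem P i, .inr ⟨_, List.get_mem _ s, rfl⟩⟩⟩,
    rfl, rfl, summary_isClosed, summary_restrict_subsumedBy, T.along a l, hsum⟩
  exact (congrArg Atom.pred hyatom).symm

/-- Induction on depth: the first atom comes from the original query or from a call strictly higher
up. -/
theorem LDTree.exists_call {tab : AnswerTable L} (htab : tab.Sound N P)
    (hch : ch.Fits N T tab) (hinit : InitFits N T init) {b : Addr P} (hb : b ∈ T.nodes)
    (hne : T.goal b ≠ []) : ∃ S : Call P, S.addr = b ∧ S.Valid N T init ch := by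
  induction hn : b.length using Nat.strong_induction_on generalizing b with
  | _ n ih =>
    obtain ⟨x, rest, hx⟩ := List.exists_cons_of_ne_nil hne
    rcases ho : x.origin with _ | ⟨a, i, s⟩
    · exact ⟨⟨b, x.atom, ⟨x.atom.pred, init b x.atom.pred⟩⟩, rfl, ⟨x, rest, hx, rfl⟩,
        .init b x rest hb hx ho, rfl,
        (absQuery_soundFor N x.atom).of_subsumedBy (hinit b hb x rest hx ho)⟩
    · have hsuff := LDTree.origin_suffix hb (hx ▸ List.mem_cons_self) ho
      have hia := LDTree.mem_of_suffix hb hsuff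
      obtain ⟨y, rest', hy, -⟩ := LDTree.exists_goal_of_cons_mem hia
      have hlt : a.length < n := hn ▸ hsuff.length_le
      obtain ⟨S, rfl, hS⟩ := ih _ hlt (LDTree.mem_of_append_mem (l := [i]) hia)
        (by simp [hy]) rfl
      obtain ⟨S', hS', hvalid, -⟩ := hS.exists_link htab hch ⟨hb, x, rest, hx, ho⟩
      exact ⟨S', hS', hvalid⟩

theorem Link.trans {S S' S'' : Call P} {C C' : AnyPair L} (h : Link N T init ch S S' C)
    (h' : Link N T init ch S' S'' C') : ∃ C'', Link N T init ch S S'' C'' := by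
  obtain ⟨p, q, A⟩ := C
  obtain ⟨q', r, B⟩ := C'
  have heq := h.range.symm.trans h'.query
  obtain rfl : q = q' := congrArg Sigma.fst heq
  have hAB : Mapping.range A.map = B.query := eq_of_heq (Sigma.mk.inj heq).2
  have hA : A.map.IsClosed := h.closed
  have hB : B.map.IsClosed := h'.closed
  -- An initial query pattern may have arcs between nodes it does not mark black, and these need not
  -- reach the mapping. The middle query is the range of a closed mapping, so its arcs do connect
  -- black nodes and `domain` applies.
  have hsub : (B.map.restrict Sum.inl).SubsumedBy (A.map.restrict Sum.inr) := by
    have hdom := h'.domain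
    dsimp only at hdom
    rw [← hAB] at hdom
    exact hdom (hA.restrict Sum.inr_injective).arcsBlack
  obtain ⟨σ, hσ⟩ := h.sound
  obtain ⟨τ, hτ⟩ := h'.sound
  have hglue : (MixedGraph.glue A.map B.map).SoundFor
      (Sum.elim (fun i : Fin p.arity => N.lin (σ.comp τ) (S.atom.val N i))
        (Sum.elim (fun i => N.lin τ (S'.atom.val N i)) fun i => S''.atom.val N i)) := by
    refine MixedGraph.SoundFor.glue ?_ hτ
    convert hσ.lin N τ using 1
    funext z
    rcases z with j | j
    exacts [N.lin_comp _ _ _, rfl]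
  let D : QMPair p r :=
    ⟨A.query, (MixedGraph.glue A.map B.map).closure.restrict (Sum.map id Sum.inr)⟩
  have hrange : Mapping.range D.map = Mapping.range B.map :=
    congrArg Mapping.range (MixedGraph.restrict_closure_glue hA hB hsub)
  refine ⟨⟨p, r, D⟩, ?_, ⟨h.mem.1, h'.mem.2⟩, h.query, ?_, ?_, fun hblack => ?_, σ.comp τ, ?_⟩
  · exact .comp _ _ _ p q r A B D h.alpha h'.alpha
      ⟨hAB, hglue.closure.consistent, rfl, rfl⟩
  · rw [h'.range]
    exact congrArg (Sigma.mk r) hrange.symm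
  · exact (hA.arcsBlack.glue hB.arcsBlack).isClosed_closure.restrict
      (Sum.map_injective.2 ⟨Function.injective_id, Sum.inr_injective⟩)
  · obtain ⟨h1, h2, h3⟩ := h.domain hblack
    refine ⟨fun i hi => ⟨_, .inl ⟨_, h1 hi, rfl⟩, .rfl⟩, fun i j hij => ?_, fun i j hij => ?_⟩
    · have hne : (Sum.inl i : Fin p.arity ⊕ (Fin q.arity ⊕ Fin r.arity)) ≠ Sum.inl j :=
        Sum.inl_injective.ne hij.ne
      exact MixedGraph.closure_adj.2 ⟨hne, SimpleGraph.Adj.reachable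
        (.inl ⟨hne, _, _, h2 hij, rfl, rfl⟩)⟩
    · exact ⟨_, _, .refl, .inl ⟨_, _, h3 i j hij, rfl, rfl⟩, .refl⟩
  · convert hglue.closure.restrict (Sum.map id Sum.inr) using 1
    funext z
    rcases z with j | j <;> rfl

/-- In an infinite LD-tree there is an infinite sequence of calls with links between all of them. -/
theorem LDTree.exists_linked_sequence {tab : AnswerTable L} (htab : tab.Sound N P)
    (hch : ch.Fits N T tab) (hinit : InitFits N T init) (hinf : T.nodes.Infinite) :
    ∃ S : ℕ → Call P, ∀ i j, i < j → ∃ C, Link N T init ch (S i) (S j) C := by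
  obtain ⟨c, hc⟩ := LDTree.exists_offspring_sequence hinf
  have hnode : ∃ S : Call P, S.addr = c 0 ∧ S.Valid N T init ch := by
    obtain ⟨i, s, hd⟩ := hc 0
    obtain ⟨l, hl, ⟨x, rest, hx, -⟩, -⟩ := hd.exists_along
    exact T.exists_call htab hch hinit (LDTree.mem_of_append_mem (hl ▸ hd.1)) (by simp [hx])
  obtain ⟨S₀, hS₀⟩ := hnode
  have hnext : ∀ (n : ℕ) (S : {S : Call P // S.addr = c n ∧ S.Valid N T init ch}),
      ∃ S' : {S : Call P // S.addr = c (n + 1) ∧ S.Valid N T init ch},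
        ∃ C, Link N T init ch S.1 S'.1 C := by
    rintro n ⟨S, hS, hvalid⟩
    obtain ⟨i, s, hd⟩ := hc n
    obtain ⟨S', hS', hvalid', hlink⟩ := hvalid.exists_link htab hch (hS ▸ hd)
    exact ⟨⟨S', hS', hvalid'⟩, hlink⟩
  choose f hf using hnext
  let S : ∀ n, {S : Call P // S.addr = c n ∧ S.Valid N T init ch} :=
    fun n => Nat.rec ⟨S₀, hS₀⟩ (fun n S => f n S) n
  refine ⟨fun n => (S n).1, fun i j hij => ?_⟩
  induction j, hij using Nat.le_induction with
  | base => exact hf i (S i)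
  | succ j _ ih =>
    obtain ⟨C, hC⟩ := ih
    obtain ⟨C', hC'⟩ := hf j (S j)
    exact hC.trans hC'

end Links

end

end TermiLog

/-! ### The termination theorem. -/

theorem theorem5 {L : FirstOrder.Language.{u, v}} (P : TermiLog.Program L)
    (Q : List (TermiLog.Atom L)) (T : TermiLog.LDTree P Q) (N : TermiLog.SymbolicNorm L)
    (tab : TermiLog.AnswerTable L) (htab : tab.Sound N P)
    (ch : TermiLog.DisjunctChoice P) (hch : ch.Fits N T tab)
    (init : (b : TermiLog.Addr P) → (p : TermiLog.Pred L) → TermiLog.Query p)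
    (hinit : TermiLog.InitFits N T init)
    (hcycle : ∀ (a b : TermiLog.Addr P) (p : TermiLog.Pred L) (A : TermiLog.QMPair p p),
      TermiLog.AlphaApp N T init ch a b p p A → A.Circular → A.HasForwardPositiveCycle) :
    T.nodes.Finite := by
  by_contra hinf
  obtain ⟨S, hS⟩ := T.exists_linked_sequence htab hch hinit hinf
  obtain ⟨C₀, -⟩ := hS 0 1 zero_lt_one
  have : Nonempty (TermiLog.AnyPair L) := ⟨C₀⟩
  choose! col hcol using hS
  obtain ⟨⟨p, q, A⟩, g, hmono, hg⟩ := TermiLog.exists_homogeneous_subsequence col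
    (TermiLog.anyPair_finite P) fun i j hij => (hcol i j hij).mem
  have hlink : ∀ m n, m < n → TermiLog.Link N T init ch (S (g m)) (S (g n)) ⟨p, q, A⟩ :=
    fun m n hmn => hg m n hmn ▸ hcol _ _ (hmono hmn)
  -- Call number `1` of the subsequence is both the source and the target of a link with the same
  -- pair, so its query is the query of that pair and also its range.
  have heq := (hlink 1 2 one_lt_two).query.symm.trans (hlink 0 1 zero_lt_one).range
  obtain rfl : p = q := congrArg Sigma.fst heq
  have hcirc : A.Circular := eq_of_heq (Sigma.mk.inj heq).2
  choose σ hσ using fun k => (hlink k (k + 1) k.lt_succ_self).sound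
  exact TermiLog.not_hasForwardPositiveCycle (u := fun k i => (S (g k)).atom.val N i)
    (fun k i => TermiLog.Atom.val_nonneg N _ _) hσ
    (hcycle _ _ p A (hlink 0 1 zero_lt_one).alpha hcirc)
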